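/- Let $n\in\mathbb N$, $s\in(0,1)$ with $n>2s$, and let $\Omega\subset\mathbb R^n$ be a bounded open set with continuous boundary. Let $K:\mathbb R^n\setminus\{0\}\to(0,+\infty)$ be such that $\min\{|x|^2,1\}\,K(x)\in L^1(\mathbb R^n)$ and, for some $\theta>0$, $K(x)\ge\theta|x|^{-(n+2s)}$ for all $x\ne0$. Let $X_0$ be the space of (a.e. classes of) Lebesgue measurable functions $g:\mathbb R^n\to\mathbb R$ such that $g|_\Omega\in L^2(\Omega)$, the map $(x,y)\mapsto (g(x)-g(y))\sqrt{K(x-y)}$ belongs to $L^2\big((\mathbb R^n\times\mathbb R^n)\setminus(\Omega^c\times\Omega^c)\big)$, where $\Omega^c=\mathbb R^n\setminus\Omega$, and $g=0$ a.e. in $\Omega^c$. It is endowed with the norm $$\|g\|_{X_0}=\Big(\int_{\mathbb R^n\times\mathbb R^n}|g(x)-g(y)|^2K(x-y)\,dx\,dy\Big)^{1/2},$$ which is induced by the scalar product $\langle u,v\rangle_{X_0}=\int_{\mathbb R^n\times\mathbb R^n}(u(x)-u(y))(v(x)-v(y))K(x-y)\,dx\,dy$. Let $f:\overline\Omega\times\mathbb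 R\to\mathbb R$ be continuous, put $F(x,t)=\int_0^tf(x,\tau)\,d\tau$, and assume: - (subcritical growth) there are $a_1,a_2>0$ and $q\in\big(2,\tfrac{2n}{n-2s}\big)$ such that $|f(x,t)|\le a_1+a_2|t|^{q-1}$ for all $x\in\Omega$, $t\in\mathbb R$; - (Ambrosetti–Rabinowitz) there are $\mu>2$ and $r>0$ such that $0<\mu F(x,t)\le t f(x,t)$ for all $x\in\Omega$ and all $t\in\mathbb R$ with $|t|\ge r$. Let $\lambda\in\mathbb R$ and, for $u\in X_0$, let $$\mathcal J_{K,\lambda}(u)=\frac12\int_{\mathbb R^n\times\mathbb R^n}|u(x)-u(y)|^2K(x-y)\,dx\,dy-\frac\lambda2\int_\Omega|u(x)|^2\,dx-\int_\Omega F(x,u(x))\,dx .$$ Then $\mathcal J_{K,\lambda}$ is well defined (that is, $F(\cdot,u(\cdot))\in L^1(\Omega)$ for every $u\in X_0$) and Fréchet differentiable on $X_0$, and it satisfies the Palais–Smale condition at every level $c\in\mathbb R$: every sequence $(u_j)_{j\in\mathbb N}$ in $X_0$ such that, as $j\to\infty$, $$\mathcal J_{K,\lambda}(u_j)\to c\quad\text{and}\quad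 \sup\big\{|\langle\mathcal J_{K,\lambda}'(u_j),\varphi\rangle| : \varphi\in X_0,\ \|\varphi\|_{X_0}=1\big\}\to0$$ has a subsequence that converges strongly in $X_0$. -/

import Mathlib

open MeasureTheory Filter Topology Set

noncomputable section

namespace NonlocalPS

/-- `ℝⁿ` with the Euclidean norm. -/
abbrev Rn (n : ℕ) : Type := EuclideanSpace ℝ (Fin n)

/-- The boundary of `Ω` is continuous: near each boundary point, and in a suitable orthonormal
frame with last vector `ν`, the set `Ω` is the region strictly above the graph of a continuous
function `γ` of the component `x - ⟪ν, x⟫ ν` of `x` orthogonal to `ν`. -/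
def HasContinuousBoundary {n : ℕ} (Ω : Set (Rn n)) : Prop :=
  ∀ p ∈ frontier Ω, ∃ r > 0, ∃ ν : Rn n, ‖ν‖ = 1 ∧ ∃ γ : Rn n → ℝ, Continuous γ ∧
    ∀ x ∈ Metric.ball p r, x ∈ Ω ↔ γ (x - inner ℝ ν x • ν) < inner ℝ ν x

/-- The standing assumptions on the order `s`, the domain `Ω` and the kernel `K`. The kernel is
defined on `ℝⁿ \ {0}`; the value `K 0` is irrelevant. -/
structure StandingAssumptions {n : ℕ} (s : ℝ) (Ω : Set (Rn n)) (K : Rn n → ℝ) : Prop where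
  s_pos : 0 < s
  s_lt_one : s < 1
  two_s_lt : 2 * s < n
  isOpen : IsOpen Ω
  isBounded : Bornology.IsBounded Ω
  boundary : HasContinuousBoundary Ω
  kernel_pos : ∀ x, x ≠ 0 → 0 < K x
  kernel_integrable : Integrable (fun x => min (‖x‖ ^ 2) 1 * K x)
  kernel_lower : ∃ θ > 0, ∀ x, x ≠ 0 → θ * ‖x‖ ^ (-((n : ℝ) + 2 * s)) ≤ K x

/-- The function `(x, y) ↦ (g x - g y) √(K (x - y))`. -/
def kernelDiff {n : ℕ} (K : Rn n → ℝ) (g : Rn n → ℝ) (p : Rn n × Rn n) : ℝ :=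
  (g p.1 - g p.2) * √(K (p.1 - p.2))

/-- Membership in `X₀` (`X` consists of the Lebesgue measurable functions on `ℝⁿ` that satisfy the
first two conditions). -/
structure MemX0 {n : ℕ} (Ω : Set (Rn n)) (K : Rn n → ℝ) (g : Rn n → ℝ) : Prop where
  memLp : MemLp g 2 (volume.restrict Ω)
  memLp_kernelDiff : MemLp (kernelDiff K g) 2 (volume.restrict (Ωᶜ ×ˢ Ωᶜ)ᶜ)
  ae_zero : ∀ᵐ x ∂(volume.restrict Ωᶜ), g x = 0

section aux

variable {n : ℕ} {s : ℝ} {Ω : Set (Rn n)} {K : Rn n → ℝ}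

theorem ae_pair {P : Rn n → Prop} (h : ∀ᵐ x, P x) : ∀ᵐ p : Rn n × Rn n, P p.1 ∧ P p.2 :=
  (Measure.quasiMeasurePreserving_fst.ae h).and (Measure.quasiMeasurePreserving_snd.ae h)

theorem MemX0.congr {g h : Rn n → ℝ} (hg : MemX0 Ω K g) (hgh : g =ᵐ[volume] h) :
    MemX0 Ω K h where
  memLp := hg.memLp.ae_eq (ae_restrict_of_ae hgh)
  memLp_kernelDiff := hg.memLp_kernelDiff.ae_eq <| ae_restrict_of_ae <| by
    filter_upwards [ae_pair hgh] with p hp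
    simp only [kernelDiff, hp.1, hp.2]
  ae_zero := by
    filter_upwards [hg.ae_zero, ae_restrict_of_ae hgh] with x hx hx'
    rw [← hx', hx]

theorem MemX0.zero : MemX0 Ω K (fun _ => 0) where
  memLp := MemLp.zero'
  memLp_kernelDiff := by
    have : kernelDiff K (fun _ : Rn n => (0 : ℝ)) = fun _ => 0 := by
      funext p; simp [kernelDiff]
    rw [this]; exact MemLp.zero'
  ae_zero := Eventually.of_forall fun _ => rfl

theorem MemX0.add {g h : Rn n → ℝ} (hg : MemX0 Ω K g) (hh : MemX0 Ω K h) :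
    MemX0 Ω K (g + h) where
  memLp := hg.memLp.add hh.memLp
  memLp_kernelDiff := by
    have : kernelDiff K (g + h) = kernelDiff K g + kernelDiff K h := by
      funext p; simp only [kernelDiff, Pi.add_apply]; ring
    rw [this]; exact hg.memLp_kernelDiff.add hh.memLp_kernelDiff
  ae_zero := by
    filter_upwards [hg.ae_zero, hh.ae_zero] with x hx hx'
    simp [hx, hx']

theorem MemX0.smul {g : Rn n → ℝ} (c : ℝ) (hg : MemX0 Ω K g) : MemX0 Ω K (c • g) where
  memLp := hg.memLp.const_smul c
  memLp_kernelDiff := by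
    have : kernelDiff K (c • g) = c • kernelDiff K g := by
      funext p; simp only [kernelDiff, Pi.smul_apply, smul_eq_mul]; ring
    rw [this]; exact hg.memLp_kernelDiff.const_smul c
  ae_zero := by
    filter_upwards [hg.ae_zero] with x hx
    simp [hx]

end aux

/-- The linear subspace of the space of a.e. classes of measurable functions underlying `X₀`. -/
def x0Submodule {n : ℕ} (Ω : Set (Rn n)) (K : Rn n → ℝ) :
    Submodule ℝ (Rn n →ₘ[(volume : Measure (Rn n))] ℝ) where
  carrier := {g | MemX0 Ω K g}
  add_mem' {g h} hg hh := (MemX0.add hg hh).congr (AEEqFun.coeFn_add g h).symm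
  zero_mem' := (MemX0.zero (Ω := Ω) (K := K)).congr (AEEqFun.coeFn_zero (β := ℝ)).symm
  smul_mem' c g hg := (MemX0.smul c hg).congr (AEEqFun.coeFn_smul c g).symm

/-- The space `X₀` of (a.e. classes of) functions of `X` that vanish a.e. outside `Ω`. The standing
assumptions are an argument of the type because they make the norm below definite. -/
def X0 {n : ℕ} {s : ℝ} {Ω : Set (Rn n)} {K : Rn n → ℝ} (_h : StandingAssumptions s Ω K) : Type :=
  x0Submodule Ω K

namespace X0

variable {n : ℕ} {s : ℝ} {Ω : Set (Rn n)} {K : Rn n → ℝ} {h : StandingAssumptions s Ω K}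

instance : AddCommGroup (X0 h) := inferInstanceAs (AddCommGroup (x0Submodule Ω K))

instance : Module ℝ (X0 h) := inferInstanceAs (Module ℝ (x0Submodule Ω K))

/-- The a.e. class of functions underlying an element of `X₀`. -/
def toAEEqFun (u : X0 h) : Rn n →ₘ[(volume : Measure (Rn n))] ℝ := Subtype.val u

/-- A representative of an element of `X₀`. -/
instance : CoeFun (X0 h) (fun _ => Rn n → ℝ) where
  coe u := (toAEEqFun u : Rn n → ℝ)

theorem memX0 (u : X0 h) : MemX0 Ω K u := Subtype.property u

theorem coe_add (u v : X0 h) : (toAEEqFun (u + v) : Rn n → ℝ) =ᵐ[volume] fun x => u x + v x :=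
  AEEqFun.coeFn_add (toAEEqFun u) (toAEEqFun v)

theorem coe_smul (c : ℝ) (u : X0 h) : (toAEEqFun (c • u) : Rn n → ℝ) =ᵐ[volume] fun x => c * u x :=
  AEEqFun.coeFn_smul c (toAEEqFun u)

theorem eq_zero_of_ae {u : X0 h} (hu : ∀ᵐ x, u x = 0) : u = 0 := by
  refine Subtype.ext (AEEqFun.ext ?_)
  have h0 : (((0 : Rn n →ₘ[(volume : Measure (Rn n))] ℝ) : Rn n → ℝ)) =ᵐ[volume] 0 :=
    AEEqFun.coeFn_zero
  filter_upwards [hu, h0] with x hx hx'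
  exact hx.trans hx'.symm

/-- The scalar product of `X₀`. -/
def scalar (u v : X0 h) : ℝ :=
  ∫ p : Rn n × Rn n, (u p.1 - u p.2) * (v p.1 - v p.2) * K (p.1 - p.2)

theorem ae_ne (h : StandingAssumptions s Ω K) : ∀ᵐ p : Rn n × Rn n, p.1 - p.2 ≠ 0 := by
  have hn : 0 < n := by
    have h1 := h.s_pos
    have h2 := h.two_s_lt
    have : (0 : ℝ) < n := by linarith
    exact_mod_cast this
  have : Nonempty (Fin n) := ⟨⟨0, hn⟩⟩
  have hm : MeasurableSet {p : Rn n × Rn n | ¬ (p.1 - p.2 ≠ 0)} := by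
    simp only [ne_eq, not_not]
    exact (isClosed_eq (by fun_prop) continuous_const).measurableSet
  rw [ae_iff]
  refine (Measure.measure_prod_null hm).2 (Eventually.of_forall fun x => ?_)
  have : Prod.mk x ⁻¹' {p : Rn n × Rn n | ¬ (p.1 - p.2 ≠ 0)} = {x} := by
    ext y; simp [sub_eq_zero, eq_comm]
  show volume (Prod.mk x ⁻¹' {p : Rn n × Rn n | ¬ (p.1 - p.2 ≠ 0)}) = 0
  rw [this, measure_singleton]

theorem memLp_kernelDiff (u : X0 h) : MemLp (kernelDiff K u) 2 := by
  have hm : MeasurableSet (Ωᶜ ×ˢ Ωᶜ) :=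
    h.isOpen.measurableSet.compl.prod h.isOpen.measurableSet.compl
  have h0 : ∀ᵐ p : Rn n × Rn n, p ∈ Ωᶜ ×ˢ Ωᶜ → kernelDiff K u p = 0 := by
    have := (ae_restrict_iff' h.isOpen.measurableSet.compl).1 (memX0 u).ae_zero
    filter_upwards [ae_pair this] with p hp hpm
    simp [kernelDiff, hp.1 hpm.1, hp.2 hpm.2]
  have h1 := (memLp_indicator_iff_restrict hm.compl).2 (memX0 u).memLp_kernelDiff
  refine h1.ae_eq ?_
  filter_upwards [h0] with p hp
  by_cases hpm : p ∈ Ωᶜ ×ˢ Ωᶜ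
  · rw [hp hpm, indicator_of_notMem]; simpa using hpm
  · rw [indicator_of_mem]; exact hpm

theorem integrand_ae_eq (u v : X0 h) :
    (fun p : Rn n × Rn n => kernelDiff K u p * kernelDiff K v p) =ᵐ[volume]
      fun p => (u p.1 - u p.2) * (v p.1 - v p.2) * K (p.1 - p.2) := by
  filter_upwards [ae_ne h] with p hp
  have hK := Real.mul_self_sqrt (h.kernel_pos _ hp).le
  simp only [kernelDiff]
  calc _ = (u p.1 - u p.2) * (v p.1 - v p.2) * (√(K (p.1 - p.2)) * √(K (p.1 - p.2))) := by ring
    _ = _ := by rw [hK]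

theorem integrable_scalar (u v : X0 h) : Integrable fun p : Rn n × Rn n =>
    (u p.1 - u p.2) * (v p.1 - v p.2) * K (p.1 - p.2) :=
  ((memLp_kernelDiff u).integrable_mul (memLp_kernelDiff v)).congr (integrand_ae_eq u v)

theorem ae_zero_of_scalar {u : X0 h} (hu : scalar u u = 0) : ∀ᵐ x, u x = 0 := by
  have hn : 0 < n := by
    have h1 := h.s_pos
    have h2 := h.two_s_lt
    have : (0 : ℝ) < n := by linarith
    exact_mod_cast this
  have : Nonempty (Fin n) := ⟨⟨0, hn⟩⟩
  have hnn : 0 ≤ᵐ[volume] fun p : Rn n × Rn n =>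
      (u p.1 - u p.2) * (u p.1 - u p.2) * K (p.1 - p.2) := by
    filter_upwards [ae_ne h] with p hp
    exact mul_nonneg (mul_self_nonneg _) (h.kernel_pos _ hp).le
  have h1 := (integral_eq_zero_iff_of_nonneg_ae hnn (integrable_scalar u u)).1 hu
  have h2 : ∀ᵐ p : Rn n × Rn n, u p.1 = u p.2 := by
    filter_upwards [h1, ae_ne h] with p hp hp'
    have hK := (h.kernel_pos _ hp').ne'
    have := (mul_eq_zero.1 hp).resolve_right hK
    exact sub_eq_zero.1 (mul_self_eq_zero.1 this)
  have h3 : ∀ᵐ x : Rn n, ∀ᵐ y : Rn n, u x = u y := Measure.ae_ae_of_ae_prod h2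
  have h4 := (ae_restrict_iff' h.isOpen.measurableSet.compl).1 (memX0 u).ae_zero
  have h5 : ∃ᵐ x : Rn n, x ∈ Ωᶜ := by
    intro hc
    have hfull : volume (Ωᶜ : Set (Rn n)) = 0 := by
      have hc' : ∀ᵐ x : Rn n, x ∉ Ωᶜ := hc
      exact measure_eq_zero_iff_ae_notMem.2 hc'
    have hlt : volume Ω < ⊤ := h.isBounded.measure_lt_top
    have huniv : volume (univ : Set (Rn n)) < ⊤ := by
      rw [← union_compl_self Ω]
      exact (measure_union_le _ _).trans_lt (by simpa [hfull] using hlt)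
    rw [measure_univ_of_isAddLeftInvariant] at huniv
    exact lt_irrefl _ huniv
  obtain ⟨x, hx, hx3, hx4⟩ := (h5.and_eventually (h3.and h4)).exists
  filter_upwards [hx3] with y hy
  rw [← hy, hx4 hx]

/-- The scalar product of `X₀` is symmetric, bilinear and positive definite. -/
instance core : InnerProductSpace.Core ℝ (X0 h) where
  inner := scalar
  conj_inner_symm u v := by
    simp only [scalar, conj_trivial]
    exact integral_congr_ae (Eventually.of_forall fun p => by ring)
  re_inner_nonneg u := by
    refine integral_nonneg_of_ae ?_
    filter_upwards [ae_ne h] with p hp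
    exact mul_nonneg (mul_self_nonneg _) (h.kernel_pos _ hp).le
  add_left u v w := by
    rw [scalar, scalar, scalar, ← integral_add (integrable_scalar u w) (integrable_scalar v w)]
    refine integral_congr_ae ?_
    filter_upwards [ae_pair (coe_add u v)] with p hp
    rw [hp.1, hp.2]; ring
  smul_left u v c := by
    simp only [scalar, conj_trivial]
    rw [← integral_const_mul]
    refine integral_congr_ae ?_
    filter_upwards [ae_pair (coe_smul c u)] with p hp
    rw [hp.1, hp.2]; ring
  definite u hu := eq_zero_of_ae (ae_zero_of_scalar hu)

instance : NormedAddCommGroup (X0 h) := (core (h := h)).toNormedAddCommGroup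

instance : InnerProductSpace ℝ (X0 h) := InnerProductSpace.ofCore (core (h := h)).toCore

theorem inner_def (u v : X0 h) : inner ℝ u v =
    ∫ p : Rn n × Rn n, (u p.1 - u p.2) * (v p.1 - v p.2) * K (p.1 - p.2) := rfl

/-- The norm of `X₀`. -/
theorem norm_def (u : X0 h) : ‖u‖ =
    (∫ p : Rn n × Rn n, |u p.1 - u p.2| ^ 2 * K (p.1 - p.2)) ^ (1 / 2 : ℝ) := by
  rw [norm_eq_sqrt_real_inner, inner_def, Real.sqrt_eq_rpow]
  simp only [sq_abs]
  simp only [sq]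

end X0

/-- The primitive `F(x, t) = ∫₀ᵗ f(x, τ) dτ`. -/
def primitive {n : ℕ} (f : Rn n → ℝ → ℝ) (x : Rn n) (t : ℝ) : ℝ := ∫ τ in (0 : ℝ)..t, f x τ

/-- The nonlinearity has subcritical growth on `Ω`. -/
def SubcriticalGrowth {n : ℕ} (s : ℝ) (Ω : Set (Rn n)) (f : Rn n → ℝ → ℝ) : Prop :=
  ∃ a₁ > 0, ∃ a₂ > 0, ∃ q : ℝ, 2 < q ∧ q < 2 * n / (n - 2 * s) ∧
    ∀ x ∈ Ω, ∀ t : ℝ, |f x t| ≤ a₁ + a₂ * |t| ^ (q - 1)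

/-- The Ambrosetti–Rabinowitz condition on `Ω`. -/
def AmbrosettiRabinowitz {n : ℕ} (Ω : Set (Rn n)) (f : Rn n → ℝ → ℝ) : Prop :=
  ∃ μ : ℝ, 2 < μ ∧ ∃ r : ℝ, 0 < r ∧ ∀ x ∈ Ω, ∀ t : ℝ, r ≤ |t| →
    0 < μ * primitive f x t ∧ μ * primitive f x t ≤ t * f x t

/-- The energy functional `J_{K,λ}` on `X₀`. -/
def energy {n : ℕ} {s : ℝ} {Ω : Set (Rn n)} {K : Rn n → ℝ} (h : StandingAssumptions s Ω K)
    (f : Rn n → ℝ → ℝ) (lam : ℝ) (u : X0 h) : ℝ :=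
  1 / 2 * (∫ p : Rn n × Rn n, |u p.1 - u p.2| ^ 2 * K (p.1 - p.2))
    - lam / 2 * (∫ x in Ω, |u x| ^ 2)
    - ∫ x in Ω, primitive f x (u x)

/-- The Palais–Smale condition at level `c`; `fderiv ℝ J u` is the Fréchet derivative `J'(u)`, and
its operator norm is the supremum of `|⟨J'(u), φ⟩|` over `‖φ‖ = 1`. -/
def PalaisSmaleAt {H : Type*} [NormedAddCommGroup H] [NormedSpace ℝ H] (J : H → ℝ) (c : ℝ) :
    Prop :=
  ∀ u : ℕ → H, Tendsto (fun j => J (u j)) atTop (𝓝 c) →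
    Tendsto (fun j => ‖fderiv ℝ J (u j)‖) atTop (𝓝 0) →
    ∃ w : H, ∃ k : ℕ → ℕ, StrictMono k ∧ Tendsto (fun i => u (k i)) atTop (𝓝 w)

end NonlocalPS

end

/-!
The critical Sobolev embedding of `X₀`, with `P = 2n / (n - 2s)`, is proved by a pointwise bound.
If `u x ≠ 0`, choose a ball around `x` whose volume is twice the Chebyshev bound for the measure of
`{|u| ≥ |u x| / 2}`; on at least half of it `|u x - u y| ≥ |u x| / 2`, so that
`|u x| ^ P ≤ C (∫ |u| ^ P) ^ (2s/n) ∫ |u x - u y|² |x - y| ^ (-(n + 2s)) dy`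
(`exists_rpow_le_gagliardoSlice`). Integrating in `x` gives the Sobolev inequality for bounded
functions, and truncation gives it for all (`exists_sobolev`). The lower bound on the kernel turns
it into `∫ |u| ^ P ≤ C ‖u‖ ^ P` on `X₀`.

The embedding of `X₀` into `L²` is compact. For `x` in a small ball, the distance of `u x` to the
mean of `u` over the ball is controlled by the same inner integral, so up to `ε ‖u‖²` the `L²` norm
is controlled by finitely many means (`X0.exists_norm_toL2_sq_le`). A diagonal argument makes the
means of a bounded sequence converge along a subsequence (`X0.exists_subseq_toL2_tendsto`). Besides,
`X₀` is complete (`X0.exists_tendsto_of_cauchySeq`).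

Since the growth of `f` is strictly below the critical one, its increments satisfy
`|f(x, t + τ) - f(x, t)| ≤ ε (1 + |t| ^ (P - 1)) + C_ε |τ| ^ (P - 1)`. The critical embedding alone
then makes `u ↦ ∫_Ω F(x, u)` Fréchet differentiable (`X0.hasFDerivAt_integral_primitive`).

For the Palais–Smale condition, suppose first that `‖u_j‖ → ∞`, and let `v_j = u_j / ‖u_j‖`
converge to `w` in `L²` along a subsequence. The Ambrosetti–Rabinowitz condition in
`μ J(u_j) - J'(u_j) u_j` gives `1 ≤ λ ‖w‖²` after division by `‖u_j‖²`. On the other hand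
`F(x, t) ≥ b(x) |t| ^ μ - C` with `b > 0` on `Ω`, and `J(u_j) / ‖u_j‖² → 0`, so
`∫ b |v_j| ^ μ → 0` and `w = 0` by Fatou's lemma, a contradiction
(`X0.not_tendsto_norm_atTop`). This argument does not need a positive lower bound for `b`, which
the condition on the open set `Ω` does not provide. Hence some subsequence is bounded, and a further
one converges in `L²`. There
`‖u_i - u_j‖² = (J'(u_i) - J'(u_j)) (u_i - u_j) + λ ‖u_i - u_j‖₂²
  + ∫ (f(x, u_i) - f(x, u_j)) (u_i - u_j)`
tends to zero, so it is a Cauchy sequence in `X₀` (`X0.cauchySeq_of_toL2`).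
-/

noncomputable section

namespace NonlocalPS

/-! ### The critical fractional Sobolev inequality -/

/-- The critical Sobolev exponent `2n / (n - 2s)`. -/
def critExp (n : ℕ) (s : ℝ) : ℝ := 2 * n / (n - 2 * s)

/-- The inner integral `∫ |u x - u y|² |x - y|^{-(n + 2s)} dy` of the squared Gagliardo seminorm,
as a function of `x`. -/
def gagliardoSlice {n : ℕ} (s : ℝ) (u : Rn n → ℝ) (x : Rn n) : ENNReal :=
  ∫⁻ y, ENNReal.ofReal ((u x - u y) ^ 2 * ‖x - y‖ ^ (-((n : ℝ) + 2 * s)))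

section Exponents

variable {n : ℕ} {s : ℝ}

theorem cast_pos_of_two_mul_lt (hs : 0 < s) (hn : 2 * s < n) : (0 : ℝ) < n := by linarith

theorem two_lt_critExp (hs : 0 < s) (hn : 2 * s < n) : 2 < critExp n s := by
  have h1 : (0 : ℝ) < n - 2 * s := by linarith
  rw [critExp, lt_div_iff₀ h1]
  linarith

theorem two_add_mul_critExp (hs : 0 < s) (hn : 2 * s < n) :
    2 + 2 * s / n * critExp n s = critExp n s := by
  have h1 : (n : ℝ) - 2 * s ≠ 0 := by linarith
  have h2 : (n : ℝ) ≠ 0 := (cast_pos_of_two_mul_lt hs hn).ne'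
  rw [critExp]
  field_simp
  ring

theorem one_sub_eq_inv_half_critExp (hs : 0 < s) (hn : 2 * s < n) :
    1 - 2 * s / n = (critExp n s / 2)⁻¹ := by
  have h1 : (n : ℝ) - 2 * s ≠ 0 := by linarith
  have h2 : (n : ℝ) ≠ 0 := (cast_pos_of_two_mul_lt hs hn).ne'
  rw [critExp]
  field_simp

end Exponents

section Sobolev

variable {n : ℕ} {s : ℝ}

theorem exists_volume_ball (hn : 0 < n) :
    ∃ v : ℝ, 0 < v ∧ ∀ (x : Rn n) (r : ℝ), 0 ≤ r →
      volume (Metric.ball x r) = ENNReal.ofReal (r ^ n * v) := by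
  have : Nonempty (Fin n) := ⟨⟨0, hn⟩⟩
  have hlt : volume (Metric.ball (0 : Rn n) 1) < ⊤ := measure_ball_lt_top
  have hpos : 0 < volume (Metric.ball (0 : Rn n) 1) := Metric.measure_ball_pos _ _ one_pos
  refine ⟨(volume (Metric.ball (0 : Rn n) 1)).toReal, ENNReal.toReal_pos hpos.ne' hlt.ne, ?_⟩
  intro x r hr
  rw [Measure.addHaar_ball _ _ hr, finrank_euclideanSpace_fin,
    ENNReal.ofReal_mul (pow_nonneg hr n), ENNReal.ofReal_toReal hlt.ne]

theorem le_gagliardoSlice {u : Rn n → ℝ} {x : Rn n} {A : Set (Rn n)}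
    (hs : 0 < s) (hA : MeasurableSet A) {c R : ℝ} (hc : 0 < c)
    (hcA : ∀ y ∈ A, c ≤ (u x - u y) ^ 2) (hRA : ∀ y ∈ A, ‖x - y‖ ≤ R) :
    ENNReal.ofReal (c * R ^ (-((n : ℝ) + 2 * s))) * volume A ≤ gagliardoSlice s u x := by
  rw [← setLIntegral_const]
  refine (setLIntegral_mono' hA fun y hy => ?_).trans (setLIntegral_le_lintegral A _)
  have hne : x - y ≠ 0 := by
    intro h0
    have := hcA y hy
    rw [sub_eq_zero.1 h0] at this
    simp at this
    linarith
  refine ENNReal.ofReal_le_ofReal (mul_le_mul (hcA y hy) ?_ ?_ (sq_nonneg _))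
  · refine Real.rpow_le_rpow_of_nonpos (norm_pos_iff.2 hne) (hRA y hy) ?_
    have : (0 : ℝ) ≤ n := n.cast_nonneg
    linarith
  · exact Real.rpow_nonneg ((norm_nonneg _).trans (hRA y hy)) _

/-- On a ball around `x` whose volume is twice the Chebyshev bound for `{|u| ≥ |u x| / 2}`, the
function stays below `|u x| / 2` on at least half of the ball, and this bounds `gagliardoSlice`
from below by `|u x|` raised to exactly the critical exponent. -/
theorem exists_rpow_le_gagliardoSlice (hs : 0 < s) (hn : 2 * s < n) :
    ∃ c : ℝ, 0 < c ∧ ∀ u : Rn n → ℝ, Measurable u → ∀ N : ℝ, 0 < N →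
      ∫⁻ x, ENNReal.ofReal (|u x| ^ critExp n s) ≤ ENNReal.ofReal N → ∀ x,
        ENNReal.ofReal (c * N ^ (-(2 * s / n)) * |u x| ^ critExp n s) ≤ gagliardoSlice s u x := by
  have hn0 := cast_pos_of_two_mul_lt hs hn
  obtain ⟨v, hv, hball⟩ := exists_volume_ball (n := n) (by exact_mod_cast hn0)
  have hP := two_lt_critExp hs hn
  have hP2 := two_add_mul_critExp hs hn
  set P := critExp n s with hPdef
  refine ⟨1 / 8 * Real.exp ((1 + 2 * s / n) * Real.log v - 2 * s / n * (P + 1) * Real.log 2),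
    by positivity, ?_⟩
  intro u hu N hN hint x
  rcases (abs_nonneg (u x)).eq_or_lt with h0 | ht
  · rw [← h0, Real.zero_rpow (by linarith)]; simp
  set t := |u x| with htdef
  set V := 2 * N * (2 / t) ^ P with hVdef
  have hV : 0 < V := by positivity
  set r := (V / v) ^ (1 / (n : ℝ)) with hrdef
  have hr : 0 < r := by positivity
  have hrn : r ^ n * v = V := by
    rw [hrdef, ← Real.rpow_natCast, ← Real.rpow_mul (by positivity),
      one_div_mul_cancel hn0.ne', Real.rpow_one, div_mul_cancel₀ _ hv.ne']
  set E := {y : Rn n | t / 2 ≤ |u y|} with hEdef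
  have hEm : MeasurableSet E := measurableSet_le measurable_const hu.abs
  have hE : volume E ≤ ENNReal.ofReal (V / 2) := by
    have h1 := mul_meas_ge_le_lintegral (μ := volume)
      (f := fun y => ENNReal.ofReal (|u y| ^ P)) (by fun_prop) (ENNReal.ofReal ((t / 2) ^ P))
    have h2 : E ⊆ {y | ENNReal.ofReal ((t / 2) ^ P) ≤ ENNReal.ofReal (|u y| ^ P)} := fun y hy =>
      ENNReal.ofReal_le_ofReal (Real.rpow_le_rpow (by positivity) hy (by linarith))
    have h3 : volume E * ENNReal.ofReal ((t / 2) ^ P) ≤ ENNReal.ofReal N := by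
      rw [mul_comm]
      exact (mul_le_mul_right (measure_mono h2) _).trans (h1.trans hint)
    have hp : 0 < (t / 2) ^ P := by positivity
    have h4 := (ENNReal.le_div_iff_mul_le (Or.inl (by simpa using hp))
      (Or.inl ENNReal.ofReal_ne_top)).2 h3
    rw [← ENNReal.ofReal_div_of_pos hp] at h4
    refine h4.trans_eq ?_
    congr 1
    rw [hVdef, ← inv_div t 2, Real.inv_rpow (by positivity)]
    field_simp
  have hA : ENNReal.ofReal (V / 2) ≤ volume (Metric.ball x r \ E) := by
    refine le_trans ?_ le_measure_sdiff
    rw [hball x r hr.le, hrn]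
    calc ENNReal.ofReal (V / 2) = ENNReal.ofReal V - ENNReal.ofReal (V / 2) := by
          rw [← ENNReal.ofReal_sub _ (by positivity)]; congr 1; ring
      _ ≤ _ := tsub_le_tsub_left hE _
  have hmain := le_gagliardoSlice (u := u) (x := x) (A := Metric.ball x r \ E) (c := (t / 2) ^ 2)
    (R := r) hs (Metric.isOpen_ball.measurableSet.diff hEm) (by positivity)
    (by
      intro y hy
      have h1 : |u y| < t / 2 := not_le.1 hy.2
      have h2 : t - |u y| ≤ |u x - u y| := abs_sub_abs_le_abs_sub _ _
      rw [← sq_abs (u x - u y)]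
      exact pow_le_pow_left₀ (by positivity) (by linarith) 2)
    (by
      intro y hy
      have := hy.1
      rw [Metric.mem_ball, dist_comm, dist_eq_norm] at this
      exact this.le)
  refine le_trans ?_ ((mul_le_mul_right hA _).trans hmain)
  rw [← ENNReal.ofReal_mul (by positivity)]
  refine ENNReal.ofReal_le_ofReal (le_of_eq ?_)
  -- Both sides are monomials in `2`, `v`, `N` and `t`: compare their logarithms.
  obtain ⟨a, rfl⟩ : ∃ a, N = Real.exp a := ⟨Real.log N, (Real.exp_log hN).symm⟩
  obtain ⟨b, hb⟩ : ∃ b, t = Real.exp b := ⟨Real.log t, (Real.exp_log ht).symm⟩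
  obtain ⟨l, hl⟩ : ∃ l, (2 : ℝ) = Real.exp l := ⟨Real.log 2, (Real.exp_log (by norm_num)).symm⟩
  obtain ⟨w, rfl⟩ : ∃ w, v = Real.exp w := ⟨Real.log v, (Real.exp_log hv).symm⟩
  have hl' : Real.log 2 = l := by rw [hl, Real.log_exp]
  have hVe : V = Real.exp (l + a + (l - b) * P) := by
    rw [hVdef, hb, Real.exp_add, Real.exp_add, Real.exp_mul, Real.exp_sub, ← hl]
  have hre : r ^ (-((n : ℝ) + 2 * s))
      = Real.exp ((l + a + (l - b) * P - w) * (-(1 + 2 * s / n))) := by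
    rw [hrdef, hVe, ← Real.exp_sub, ← Real.exp_mul, ← Real.exp_mul]
    congr 1
    field_simp
  rw [hre, hVe, hl', Real.log_exp, hb]
  have e1 : (Real.exp b / 2) ^ 2 = 1 / 4 * Real.exp (2 * b) := by
    rw [div_pow, ← Real.exp_nat_mul]; push_cast; ring
  rw [e1, ← Real.exp_mul, ← Real.exp_mul, mul_assoc, mul_assoc, ← Real.exp_add, ← Real.exp_add]
  have e2 : 1 / 4 * Real.exp (2 * b) * Real.exp ((l + a + (l - b) * P - w) * (-(1 + 2 * s / n))) *
      (Real.exp (l + a + (l - b) * P) / 2) = 1 / 8 * Real.exp (2 * b +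
        (l + a + (l - b) * P - w) * (-(1 + 2 * s / n)) + (l + a + (l - b) * P)) := by
    rw [Real.exp_add _ (l + a + (l - b) * P), Real.exp_add (2 * b)]; ring
  rw [e2]
  congr 2
  linear_combination (-b) * hP2

/-- The critical Sobolev inequality for functions whose critical integral is known to be finite:
integrating the pointwise bound, the integral of `|u|^{2n/(n-2s)}` can be divided out. -/
theorem exists_sobolev_of_lt_top (hs : 0 < s) (hn : 2 * s < n) :
    ∃ C : ℝ, 0 < C ∧ ∀ u : Rn n → ℝ, Measurable u → ∀ S : ℝ, 0 ≤ S →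
      ∫⁻ x, ENNReal.ofReal (|u x| ^ critExp n s) < ⊤ →
      ∫⁻ x, gagliardoSlice s u x ≤ ENNReal.ofReal S →
        ∫⁻ x, ENNReal.ofReal (|u x| ^ critExp n s)
          ≤ ENNReal.ofReal (C * S ^ (critExp n s / 2)) := by
  obtain ⟨c, hc, hpt⟩ := exists_rpow_le_gagliardoSlice hs hn
  have hP := two_lt_critExp hs hn
  have hP2 := one_sub_eq_inv_half_critExp hs hn
  set P := critExp n s with hPdef
  refine ⟨c⁻¹ ^ (P / 2), by positivity, ?_⟩
  intro u hu S hS hfin hG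
  set I := ∫⁻ x, ENNReal.ofReal (|u x| ^ P) with hI
  rcases eq_or_ne I 0 with h0 | h0
  · rw [h0]; exact zero_le
  have hN : 0 < I.toReal := ENNReal.toReal_pos h0 hfin.ne
  have hIN : I = ENNReal.ofReal I.toReal := (ENNReal.ofReal_toReal hfin.ne).symm
  set N := I.toReal
  have h1 := (lintegral_mono (hpt u hu N hN hIN.le)).trans hG
  have h2 : ∫⁻ x, ENNReal.ofReal (c * N ^ (-(2 * s / n)) * |u x| ^ P)
      = ENNReal.ofReal (c * N ^ (-(2 * s / n)) * N) := by
    have hk : 0 ≤ c * N ^ (-(2 * s / n)) := by positivity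
    simp_rw [ENNReal.ofReal_mul hk]
    rw [lintegral_const_mul _ (by fun_prop), ← hI, ← hIN]
  rw [h2, ENNReal.ofReal_le_ofReal_iff hS, mul_assoc] at h1
  have h3 : N ^ (-(2 * s / n)) * N = N ^ (P / 2)⁻¹ := by
    rw [← hP2, sub_eq_add_neg, Real.rpow_add hN, Real.rpow_one, mul_comm]
  rw [h3] at h1
  rw [hIN]
  refine ENNReal.ofReal_le_ofReal ?_
  rw [← Real.mul_rpow (by positivity) hS]
  have h4 : N ^ (P / 2)⁻¹ ≤ c⁻¹ * S := by
    rw [inv_mul_eq_div, le_div_iff₀ hc]; linarith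
  calc N = (N ^ (P / 2)⁻¹) ^ (P / 2) := by
        rw [← Real.rpow_mul hN.le, inv_mul_cancel₀ (by linarith), Real.rpow_one]
    _ ≤ _ := Real.rpow_le_rpow (by positivity) h4 (by linarith)

/-- The function `t ↦ max (-M) (min t M)`. -/
def truncate (M t : ℝ) : ℝ := max (-M) (min t M)

theorem measurable_truncate (M : ℝ) : Measurable (truncate M) := by
  unfold truncate; fun_prop

theorem abs_truncate_le {M : ℝ} (hM : 0 ≤ M) (t : ℝ) : |truncate M t| ≤ M := by
  rw [abs_le]
  exact ⟨le_max_left _ _, max_le (by linarith) (min_le_right _ _)⟩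

theorem truncate_eq_self {M t : ℝ} (h : |t| ≤ M) : truncate M t = t := by
  rw [abs_le] at h
  rw [truncate, min_eq_left h.2, max_eq_right h.1]

theorem abs_truncate_sub_le (M a b : ℝ) : |truncate M a - truncate M b| ≤ |a - b| := by
  refine (abs_max_sub_max_le_max (-M) (min a M) (-M) (min b M)).trans (max_le (by simp) ?_)
  refine (abs_min_sub_min_le_max a M b M).trans ?_
  simp

/-- The critical Sobolev inequality, from the bounded case by truncation. -/
theorem exists_sobolev (hs : 0 < s) (hn : 2 * s < n) :
    ∃ C : ℝ, 0 < C ∧ ∀ u : Rn n → ℝ, Measurable u → ∀ Ω : Set (Rn n), volume Ω < ⊤ →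
      (∀ᵐ x, x ∉ Ω → u x = 0) → ∀ S : ℝ, 0 ≤ S →
      ∫⁻ x, gagliardoSlice s u x ≤ ENNReal.ofReal S →
        ∫⁻ x, ENNReal.ofReal (|u x| ^ critExp n s)
          ≤ ENNReal.ofReal (C * S ^ (critExp n s / 2)) := by
  obtain ⟨C, hC, hsob⟩ := exists_sobolev_of_lt_top hs hn
  have hP := two_lt_critExp hs hn
  set P := critExp n s with hPdef
  refine ⟨C, hC, ?_⟩
  intro u hu Ω hΩ h0 S hS hG
  have hm : ∀ M : ℕ, Measurable fun x => truncate M (u x) := fun M =>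
    (measurable_truncate M).comp hu
  have hbd : ∀ M : ℕ, ∫⁻ x, ENNReal.ofReal (|truncate M (u x)| ^ P)
      ≤ ENNReal.ofReal (C * S ^ (P / 2)) := by
    intro M
    refine hsob _ (hm M) S hS ?_ ?_
    · have hle : ∀ᵐ x, ENNReal.ofReal (|truncate M (u x)| ^ P)
          ≤ (toMeasurable volume Ω).indicator (fun _ => ENNReal.ofReal ((M : ℝ) ^ P)) x := by
        filter_upwards [h0] with x hx
        by_cases hxΩ : x ∈ toMeasurable volume Ω
        · rw [indicator_of_mem hxΩ]
          exact ENNReal.ofReal_le_ofReal (Real.rpow_le_rpow (abs_nonneg _)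
            (abs_truncate_le M.cast_nonneg _) (by linarith))
        · have : u x = 0 := hx fun hh => hxΩ (subset_toMeasurable _ _ hh)
          rw [this, truncate_eq_self (by simp), abs_zero, Real.zero_rpow (by linarith)]
          simp
      refine (lintegral_mono_ae hle).trans_lt ?_
      rw [lintegral_indicator_const (measurableSet_toMeasurable _ _), measure_toMeasurable]
      exact ENNReal.mul_lt_top ENNReal.ofReal_lt_top hΩ
    · refine le_trans (lintegral_mono fun x => lintegral_mono fun y => ?_) hG
      refine ENNReal.ofReal_le_ofReal (mul_le_mul_of_nonneg_right ?_ (by positivity))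
      exact sq_le_sq.2 (abs_truncate_sub_le _ _ _)
  have hlim : ∀ x, ENNReal.ofReal (|u x| ^ P)
      = liminf (fun M : ℕ => ENNReal.ofReal (|truncate M (u x)| ^ P)) atTop := by
    intro x
    refine (Tendsto.liminf_eq (tendsto_const_nhds.congr' ?_)).symm
    obtain ⟨M₀, hM₀⟩ := exists_nat_ge |u x|
    filter_upwards [eventually_ge_atTop M₀] with M hM
    rw [truncate_eq_self (hM₀.trans (by exact_mod_cast hM))]
  calc ∫⁻ x, ENNReal.ofReal (|u x| ^ P)
      = ∫⁻ x, liminf (fun M : ℕ => ENNReal.ofReal (|truncate M (u x)| ^ P)) atTop :=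
        lintegral_congr hlim
    _ ≤ liminf (fun M : ℕ => ∫⁻ x, ENNReal.ofReal (|truncate M (u x)| ^ P)) atTop :=
        lintegral_liminf_le fun M => by have := hm M; fun_prop
    _ ≤ _ := by
      refine (liminf_le_liminf (Eventually.of_forall hbd)).trans ?_
      rw [liminf_const]

end Sobolev

/-! ### Embeddings of `X₀` and completeness -/

theorem exists_subseq_tendsto_ae {α : Type*} [MeasurableSpace α] {ν : Measure α}
    {g : ℕ → Lp ℝ 2 ν} {w : Lp ℝ 2 ν} (hg : Tendsto g atTop (𝓝 w)) :
    ∃ k : ℕ → ℕ, StrictMono k ∧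
      ∀ᵐ x ∂ν, Tendsto (fun i => (g (k i) : α → ℝ) x) atTop (𝓝 (w x)) :=
  (tendstoInMeasure_of_tendsto_Lp hg).exists_seq_tendsto_ae

namespace X0

variable {n : ℕ} {s : ℝ} {Ω : Set (Rn n)} {K : Rn n → ℝ} {h : StandingAssumptions s Ω K}

theorem measurable_coe (u : X0 h) : Measurable (u : Rn n → ℝ) :=
  (AEEqFun.stronglyMeasurable (toAEEqFun u)).measurable

theorem ae_eq_zero_off (u : X0 h) : ∀ᵐ x, x ∉ Ω → u x = 0 :=
  (ae_restrict_iff' h.isOpen.measurableSet.compl).1 (memX0 u).ae_zero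

theorem volume_lt_top (h : StandingAssumptions s Ω K) : volume Ω < ⊤ := h.isBounded.measure_lt_top

theorem norm_sq_def (u : X0 h) : ‖u‖ ^ 2 =
    ∫ p : Rn n × Rn n, (u p.1 - u p.2) * (u p.1 - u p.2) * K (p.1 - p.2) := by
  rw [← real_inner_self_eq_norm_sq, inner_def]

theorem exists_lintegral_gagliardoSlice_le (h : StandingAssumptions s Ω K) :
    ∃ A : ℝ, 0 < A ∧ ∀ u : X0 h,
      ∫⁻ x, gagliardoSlice s (u : Rn n → ℝ) x ≤ ENNReal.ofReal (A * ‖u‖ ^ 2) := by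
  obtain ⟨θ, hθ, hK⟩ := h.kernel_lower
  refine ⟨θ⁻¹, inv_pos.2 hθ, fun u => ?_⟩
  have hu := measurable_coe u
  have h1 : ∫⁻ x, gagliardoSlice s (u : Rn n → ℝ) x = ∫⁻ p : Rn n × Rn n,
      ENNReal.ofReal ((u p.1 - u p.2) ^ 2 * ‖p.1 - p.2‖ ^ (-((n : ℝ) + 2 * s))) := by
    rw [Measure.volume_eq_prod, lintegral_prod _ (by fun_prop)]
    rfl
  have hint := (integrable_scalar u u).const_mul θ⁻¹
  have hnn : 0 ≤ᵐ[volume] fun p : Rn n × Rn n =>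
      θ⁻¹ * ((u p.1 - u p.2) * (u p.1 - u p.2) * K (p.1 - p.2)) := by
    filter_upwards [ae_ne h] with p hp
    exact mul_nonneg (inv_pos.2 hθ).le (mul_nonneg (mul_self_nonneg _) (h.kernel_pos _ hp).le)
  rw [h1, norm_sq_def, ← integral_const_mul, ofReal_integral_eq_lintegral_ofReal hint hnn]
  refine lintegral_mono_ae ?_
  filter_upwards [ae_ne h] with p hp
  refine ENNReal.ofReal_le_ofReal ?_
  rw [inv_mul_eq_div, le_div_iff₀ hθ]
  have := mul_le_mul_of_nonneg_left (hK _ hp) (sq_nonneg (u p.1 - u p.2))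
  linarith

/-- The critical Sobolev embedding `X₀ ⊂ L^{2n/(n-2s)}`. -/
theorem exists_integral_rpow_le (h : StandingAssumptions s Ω K) :
    ∃ C : ℝ, 0 < C ∧ ∀ u : X0 h, Integrable (fun x => |u x| ^ critExp n s) ∧
      ∫ x, |u x| ^ critExp n s ≤ C * ‖u‖ ^ critExp n s := by
  obtain ⟨A, hA, hG⟩ := exists_lintegral_gagliardoSlice_le h
  obtain ⟨C, hC, hsob⟩ := exists_sobolev h.s_pos h.two_s_lt
  refine ⟨C * A ^ (critExp n s / 2), by positivity, fun u => ?_⟩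
  have h1 := hsob u (measurable_coe u) Ω (volume_lt_top h) (ae_eq_zero_off u) _ (by positivity)
    (hG u)
  have h2 : (A * ‖u‖ ^ 2) ^ (critExp n s / 2) = A ^ (critExp n s / 2) * ‖u‖ ^ critExp n s := by
    rw [Real.mul_rpow hA.le (by positivity), ← Real.rpow_natCast, ← Real.rpow_mul (norm_nonneg _)]
    congr 2
    push_cast
    ring
  rw [h2, ← mul_assoc] at h1
  have hnn : ∀ x, 0 ≤ |u x| ^ critExp n s := fun x => by positivity
  have hm : AEStronglyMeasurable (fun x => |u x| ^ critExp n s) volume := by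
    have := measurable_coe u
    exact Measurable.aestronglyMeasurable (by fun_prop)
  have hint : Integrable (fun x => |u x| ^ critExp n s) :=
    (lintegral_ofReal_ne_top_iff_integrable hm (Eventually.of_forall hnn)).1
      (h1.trans_lt ENNReal.ofReal_lt_top).ne
  refine ⟨hint, ?_⟩
  rwa [← ofReal_integral_eq_lintegral_ofReal hint (Eventually.of_forall hnn),
    ENNReal.ofReal_le_ofReal_iff (by positivity)] at h1

theorem memLp_two (u : X0 h) : MemLp (u : Rn n → ℝ) 2 := by
  refine ((memLp_indicator_iff_restrict h.isOpen.measurableSet).2 (memX0 u).memLp).ae_eq ?_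
  filter_upwards [ae_eq_zero_off u] with x hx
  by_cases hxΩ : x ∈ Ω
  · rw [indicator_of_mem hxΩ]
  · rw [indicator_of_notMem hxΩ, hx hxΩ]

theorem integrable_mul_coe (u v : X0 h) : Integrable fun x => u x * v x :=
  (memLp_two u).integrable_mul (memLp_two v)

theorem sq_le_one_add_rpow {P a : ℝ} (hP : 2 ≤ P) (ha : 0 ≤ a) : a ^ 2 ≤ 1 + a ^ P := by
  have h0 : 0 ≤ a ^ P := by positivity
  rcases le_total a 1 with h1 | h1
  · nlinarith
  · have := Real.rpow_le_rpow_of_exponent_le h1 hP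
    rw [Real.rpow_two] at this
    linarith

theorem setIntegral_eq_integral (u : X0 h) {g : Rn n → ℝ} (hg : ∀ x, u x = 0 → g x = 0) :
    ∫ x in Ω, g x = ∫ x, g x := by
  refine setIntegral_eq_integral_of_ae_compl_eq_zero ?_
  filter_upwards [ae_eq_zero_off u] with x hx hxΩ
  exact hg x (hx hxΩ)

theorem exists_integral_sq_le (h : StandingAssumptions s Ω K) :
    ∃ C : ℝ, 0 ≤ C ∧ ∀ u : X0 h, ∫ x, u x * u x ≤ C ^ 2 * ‖u‖ ^ 2 := by
  obtain ⟨C, hC, hsob⟩ := exists_integral_rpow_le h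
  have hP := two_lt_critExp h.s_pos h.two_s_lt
  refine ⟨√(volume.real Ω + C), Real.sqrt_nonneg _, fun u => ?_⟩
  rw [Real.sq_sqrt (by positivity)]
  rcases (norm_nonneg u).eq_or_lt with h0 | hρ
  · have hu : u = 0 := norm_eq_zero.1 h0.symm
    have h00 : (toAEEqFun (0 : X0 h) : Rn n → ℝ) =ᵐ[volume] 0 := AEEqFun.coeFn_zero
    have : ∫ x, u x * u x = 0 := by
      rw [hu]
      refine integral_eq_zero_of_ae ?_
      filter_upwards [h00] with x hx
      simp [hx]
    rw [this]
    positivity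
  have : IsFiniteMeasure (volume.restrict Ω) := ⟨by simpa using volume_lt_top h⟩
  set P := critExp n s
  have hpt : ∀ x, u x * u x ≤ ‖u‖ ^ 2 * (1 + (‖u‖ ^ P)⁻¹ * |u x| ^ P) := by
    intro x
    have h1 := sq_le_one_add_rpow hP.le (a := |u x| / ‖u‖) (by positivity)
    rw [Real.div_rpow (abs_nonneg _) hρ.le, div_pow, div_le_iff₀ (by positivity), sq_abs] at h1
    calc u x * u x = u x ^ 2 := by ring
      _ ≤ _ := h1
      _ = _ := by rw [div_eq_inv_mul]; ring
  have hi2 : IntegrableOn (fun x => ‖u‖ ^ 2 * (1 + (‖u‖ ^ P)⁻¹ * |u x| ^ P)) Ω :=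
    (((integrable_const _).add (((hsob u).1.const_mul _).integrableOn)).const_mul _)
  rw [← setIntegral_eq_integral u (fun x hx => by rw [hx, zero_mul])]
  refine (setIntegral_mono (integrable_mul_coe u u).integrableOn hi2 hpt).trans ?_
  rw [integral_const_mul, integral_add (integrable_const _) (((hsob u).1.const_mul _).integrableOn),
    integral_const_mul, setIntegral_eq_integral u (g := fun x => |u x| ^ P) (fun x hx => by
      rw [hx, abs_zero, Real.zero_rpow (by linarith)])]
  have h3 : (‖u‖ ^ P)⁻¹ * ∫ x, |u x| ^ P ≤ C := by
    rw [inv_mul_le_iff₀ (by positivity), mul_comm]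
    exact (hsob u).2
  rw [mul_comm]
  refine mul_le_mul_of_nonneg_right ?_ (by positivity)
  simpa using h3

theorem norm_toLp_sq (u : X0 h) : ‖(memLp_two u).toLp _‖ ^ 2 = ∫ x, u x * u x := by
  rw [← real_inner_self_eq_norm_sq, L2.inner_def]
  refine integral_congr_ae ?_
  filter_upwards [(memLp_two u).coeFn_toLp] with x hx
  rw [hx]
  rfl

/-- The continuous embedding of `X₀` into `L²(ℝⁿ)`. -/
def toL2 (h : StandingAssumptions s Ω K) : X0 h →L[ℝ] Lp ℝ 2 (volume : Measure (Rn n)) :=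
  LinearMap.mkContinuousOfExistsBound
    { toFun := fun u => (memLp_two u).toLp _
      map_add' := fun u v => by
        rw [← MemLp.toLp_add]
        exact MemLp.toLp_congr _ _ (coe_add u v)
      map_smul' := fun c u => by
        rw [RingHom.id_apply, ← MemLp.toLp_const_smul]
        exact MemLp.toLp_congr _ _ (coe_smul c u) }
    (by
      obtain ⟨C, hC, hb⟩ := exists_integral_sq_le h
      refine ⟨C, fun u => ?_⟩
      refine abs_le_of_sq_le_sq' ?_ (by positivity) |>.2
      rw [mul_pow]
      exact (norm_toLp_sq u).trans_le (hb u))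

theorem coeFn_toL2 (u : X0 h) : (toL2 h u : Rn n → ℝ) =ᵐ[volume] u := (memLp_two u).coeFn_toLp

theorem norm_toL2_sq (u : X0 h) : ‖toL2 h u‖ ^ 2 = ∫ x in Ω, u x ^ 2 := by
  rw [setIntegral_eq_integral u (fun x hx => by rw [hx]; ring)]
  simp_rw [sq (toAEEqFun u _)]
  exact norm_toLp_sq u

/-- The isometric embedding `u ↦ (u x - u y) √(K (x - y))` of `X₀` into `L²(ℝⁿ × ℝⁿ)`. -/
def toKernelDiff (h : StandingAssumptions s Ω K) :
    X0 h →ₗᵢ[ℝ] Lp ℝ 2 (volume : Measure (Rn n × Rn n)) where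
  toFun u := (memLp_kernelDiff u).toLp _
  map_add' u v := by
    rw [← MemLp.toLp_add]
    refine MemLp.toLp_congr _ _ ?_
    filter_upwards [ae_pair (coe_add u v)] with p hp
    simp only [kernelDiff, Pi.add_apply, hp.1, hp.2]
    ring
  map_smul' c u := by
    rw [RingHom.id_apply, ← MemLp.toLp_const_smul]
    refine MemLp.toLp_congr _ _ ?_
    filter_upwards [ae_pair (coe_smul c u)] with p hp
    simp only [kernelDiff, Pi.smul_apply, smul_eq_mul, hp.1, hp.2]
    ring
  norm_map' u := by
    refine (sq_eq_sq₀ (norm_nonneg _) (norm_nonneg _)).1 ?_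
    rw [norm_sq_def, ← real_inner_self_eq_norm_sq, L2.inner_def]
    refine integral_congr_ae ?_
    filter_upwards [(memLp_kernelDiff u).coeFn_toLp, integrand_ae_eq u u] with p hp hp'
    rw [← hp']
    simp only [LinearMap.coe_mk, AddHom.coe_mk]
    rw [hp]
    rfl

theorem coeFn_toKernelDiff (u : X0 h) :
    (toKernelDiff h u : Rn n × Rn n → ℝ) =ᵐ[volume] kernelDiff K u :=
  (memLp_kernelDiff u).coeFn_toLp

/-- `X₀` is complete: the graph of `w ↦ (w x - w y) √(K (x - y))` is closed in `L² × L²`, as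
convergence in `L²` yields almost everywhere convergence of a subsequence. -/
theorem exists_tendsto_of_cauchySeq {u : ℕ → X0 h} (hu : CauchySeq u) :
    ∃ w, Tendsto u atTop (𝓝 w) := by
  obtain ⟨w, hw⟩ := cauchySeq_tendsto_of_complete
    ((toL2 h).uniformContinuous.comp_cauchySeq hu)
  obtain ⟨G, hG⟩ := cauchySeq_tendsto_of_complete
    ((toKernelDiff h).isometry.uniformContinuous.comp_cauchySeq hu)
  obtain ⟨k₁, hk₁, hae₁⟩ := exists_subseq_tendsto_ae hw
  obtain ⟨k₂, hk₂, hae₂⟩ := exists_subseq_tendsto_ae (hG.comp hk₁.tendsto_atTop)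
  have hlim₁ : ∀ᵐ x, Tendsto (fun i => (u (k₁ (k₂ i))) x) atTop (𝓝 (w x)) := by
    filter_upwards [hae₁, ae_all_iff.2 fun i => coeFn_toL2 (u i)] with x hx hx'
    refine (hx.comp hk₂.tendsto_atTop).congr fun i => ?_
    exact hx' _
  have hGw : (G : Rn n × Rn n → ℝ) =ᵐ[volume] kernelDiff K w := by
    filter_upwards [ae_pair hlim₁, hae₂, ae_all_iff.2 fun i => coeFn_toKernelDiff (u i)]
      with p hp hpG hpk
    have h1 : Tendsto (fun i => kernelDiff K (u (k₁ (k₂ i))) p) atTop (𝓝 (kernelDiff K w p)) :=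
      (hp.1.sub hp.2).mul_const _
    refine tendsto_nhds_unique (hpG.congr fun i => ?_) h1
    exact hpk _
  have hmem : MemX0 Ω K w :=
    { memLp := (Lp.memLp w).restrict _
      memLp_kernelDiff := ((Lp.memLp G).ae_eq hGw).restrict _
      ae_zero := by
        rw [ae_restrict_iff' h.isOpen.measurableSet.compl]
        filter_upwards [hlim₁, ae_all_iff.2 fun i => ae_eq_zero_off (u i)] with x hx hx' hxΩ
        refine tendsto_nhds_unique hx (tendsto_const_nhds.congr fun i => ?_)
        exact (hx' _ hxΩ).symm }
  let w' : X0 h := ⟨w.1, hmem⟩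
  have hw' : toKernelDiff h w' = G := by
    refine Lp.ext ((coeFn_toKernelDiff w').trans hGw.symm)
  refine ⟨w', ?_⟩
  rw [(toKernelDiff h).isometry.isEmbedding.tendsto_nhds_iff, hw']
  exact hG

end X0

/-! ### Compactness of the embedding into `L²` -/

/-- The distance of `w x` to the mean of `w` over a ball of finite volume is controlled by the mean
of `|w x - w y|²` over that ball. -/
theorem mul_sq_sub_average_le {α : Type*} [MeasurableSpace α] {ν : Measure α} [IsFiniteMeasure ν]
    {w : α → ℝ} (hw : MemLp w 2 ν) {b : ℝ} (hb : 0 < b) (hν : ν.real univ = b) (a : ℝ) :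
    b * (a - b⁻¹ * ∫ y, w y ∂ν) ^ 2 ≤ ∫ y, (a - w y) ^ 2 ∂ν := by
  have h1 : Integrable w ν := hw.integrable (by norm_num)
  have h2 : Integrable (fun y => w y ^ 2) ν := hw.integrable_sq
  have hexp : ∀ c : ℝ,
      ∫ y, (c - w y) ^ 2 ∂ν = b * c ^ 2 - 2 * c * ∫ y, w y ∂ν + ∫ y, w y ^ 2 ∂ν := by
    intro c
    have : ∀ y, (c - w y) ^ 2 = c ^ 2 - 2 * c * w y + w y ^ 2 := fun y => by ring
    simp_rw [this]
    rw [integral_add (f := fun y => c ^ 2 - 2 * c * w y)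
        ((integrable_const _).sub (h1.const_mul _)) h2,
      integral_sub (integrable_const _) (h1.const_mul _), integral_const_mul, integral_const, hν,
      smul_eq_mul]
  have h0 : 0 ≤ ∫ y, (b⁻¹ * (∫ y, w y ∂ν) - w y) ^ 2 ∂ν := integral_nonneg fun y => sq_nonneg _
  rw [hexp] at h0 ⊢
  set I := ∫ y, w y ∂ν
  have e1 : b * (b⁻¹ * I) ^ 2 = b⁻¹ * I ^ 2 := by field_simp
  have e2 : b * (a - b⁻¹ * I) ^ 2 = b * a ^ 2 - 2 * a * I + b⁻¹ * I ^ 2 := by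
    field_simp
    ring
  rw [e1] at h0
  rw [e2]
  linarith

namespace X0

variable {n : ℕ} {s : ℝ} {Ω : Set (Rn n)} {K : Rn n → ℝ} {h : StandingAssumptions s Ω K}

theorem setLIntegral_ball_le (hs : 0 < s) {u : Rn n → ℝ} {c x : Rn n} {δ : ℝ}
    (hx : x ∈ Metric.ball c δ) :
    ∫⁻ y in Metric.ball c δ, ENNReal.ofReal ((u x - u y) ^ 2)
      ≤ ENNReal.ofReal ((2 * δ) ^ ((n : ℝ) + 2 * s)) * gagliardoSlice s u x := by
  rw [gagliardoSlice, ← lintegral_const_mul' _ _ ENNReal.ofReal_ne_top]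
  refine (setLIntegral_mono' Metric.isOpen_ball.measurableSet fun y hy => ?_).trans
    (setLIntegral_le_lintegral _ _)
  have hδ : 0 < δ := Metric.pos_of_mem_ball hx
  rw [← ENNReal.ofReal_mul (by positivity)]
  refine ENNReal.ofReal_le_ofReal ?_
  rcases eq_or_ne x y with rfl | hxy
  · simp
  have hpos : 0 < ‖x - y‖ := norm_pos_iff.2 (sub_ne_zero.2 hxy)
  have hlt : ‖x - y‖ ≤ 2 * δ := by
    rw [← dist_eq_norm]
    have := dist_triangle_right x y c
    have h1 := Metric.mem_ball.1 hx
    have h2 := Metric.mem_ball.1 hy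
    linarith
  have h3 : ‖x - y‖ ^ ((n : ℝ) + 2 * s) ≤ (2 * δ) ^ ((n : ℝ) + 2 * s) :=
    Real.rpow_le_rpow hpos.le hlt (by positivity)
  have h4 : 1 ≤ (2 * δ) ^ ((n : ℝ) + 2 * s) * ‖x - y‖ ^ (-((n : ℝ) + 2 * s)) := by
    rw [Real.rpow_neg hpos.le, ← div_eq_mul_inv, le_div_iff₀ (by positivity), one_mul]
    exact h3
  nlinarith [sq_nonneg (u x - u y)]

/-- An Ehrling-type inequality: up to a small multiple of the `X₀` norm, the `L²` norm is controlled
by finitely many linear functionals, namely the means over the balls of a finite cover of `Ω`. -/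
theorem exists_norm_toL2_sq_le (h : StandingAssumptions s Ω K) {ε : ℝ} (hε : 0 < ε) :
    ∃ (t : Finset (Rn n)) (e : Rn n → Lp ℝ 2 (volume : Measure (Rn n))), ∀ u : X0 h,
      ‖toL2 h u‖ ^ 2 ≤ ε * ‖u‖ ^ 2 + ∑ c ∈ t, (inner ℝ (e c) (toL2 h u)) ^ 2 := by
  have hn0 := cast_pos_of_two_mul_lt h.s_pos h.two_s_lt
  obtain ⟨A, hA, hG⟩ := exists_lintegral_gagliardoSlice_le h
  obtain ⟨v, hv, hball⟩ := exists_volume_ball (n := n) (by exact_mod_cast hn0)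
  have hs := h.s_pos
  -- Pick the radius of the cover.
  set B := 2 * (2 : ℝ) ^ ((n : ℝ) + 2 * s) / v * A with hB
  have hBpos : 0 < B := by positivity
  obtain ⟨δ, hδ, hδε⟩ : ∃ δ : ℝ, 0 < δ ∧ B * δ ^ (2 * s) ≤ ε := by
    refine ⟨(ε / B) ^ (1 / (2 * s)), by positivity, le_of_eq ?_⟩
    rw [← Real.rpow_mul (by positivity), one_div_mul_cancel (by positivity), Real.rpow_one]
    field_simp
  obtain ⟨t, htfin, ht⟩ := Metric.totallyBounded_iff.1
    (h.isBounded.isCompact_closure.totallyBounded.subset subset_closure) δ hδ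
  set b := δ ^ n * v with hb
  have hbpos : 0 < b := by positivity
  have hvol : ∀ c : Rn n, volume (Metric.ball c δ) = ENNReal.ofReal b := fun c => hball c δ hδ.le
  have hvolr : ∀ c : Rn n, volume.real (Metric.ball c δ) = b := fun c => by
    rw [measureReal_def, hvol, ENNReal.toReal_ofReal hbpos.le]
  set V := volume.real Ω with hV
  have hmeas : ∀ c : Rn n, MeasurableSet (Metric.ball c δ) := fun c =>
    Metric.isOpen_ball.measurableSet
  refine ⟨htfin.toFinset, fun c => (√(2 * V) * b⁻¹) • indicatorConstLp 2 (hmeas c)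
    (by rw [hvol]; exact ENNReal.ofReal_ne_top) 1, fun u => ?_⟩
  have hinner : ∀ c : Rn n, (inner ℝ ((√(2 * V) * b⁻¹) • indicatorConstLp 2 (hmeas c)
      (by rw [hvol]; exact ENNReal.ofReal_ne_top) (1 : ℝ)) (toL2 h u)) ^ 2
      = 2 * V * (b⁻¹ * ∫ y in Metric.ball c δ, u y) ^ 2 := by
    intro c
    rw [real_inner_smul_left, L2.inner_indicatorConstLp_one, mul_assoc, mul_pow,
      Real.sq_sqrt (by positivity)]
    congr 3
    exact integral_congr_ae (ae_restrict_of_ae (coeFn_toL2 u))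
  simp_rw [hinner]
  set m : Rn n → ℝ := fun c => b⁻¹ * ∫ y in Metric.ball c δ, u y with hm
  change _ ≤ ε * ‖u‖ ^ 2 + ∑ c ∈ htfin.toFinset, 2 * V * (m c) ^ 2
  set σ := ∑ c ∈ htfin.toFinset, 2 * (m c) ^ 2 with hσ
  have hσ0 : 0 ≤ σ := Finset.sum_nonneg fun c _ => by positivity
  have hsum : ∑ c ∈ htfin.toFinset, 2 * V * (m c) ^ 2 = V * σ := by
    rw [hσ, Finset.mul_sum]
    exact Finset.sum_congr rfl fun c _ => by ring
  rw [hsum]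
  have hpt : ∀ x ∈ Ω, ENNReal.ofReal (u x ^ 2) ≤ ENNReal.ofReal (B / A * δ ^ (2 * s)) *
      gagliardoSlice s (u : Rn n → ℝ) x + ENNReal.ofReal σ := by
    intro x hx
    obtain ⟨c, hct, hxc⟩ := mem_iUnion₂.1 (ht hx)
    have : IsFiniteMeasure (volume.restrict (Metric.ball c δ)) :=
      ⟨by simpa using measure_ball_lt_top⟩
    have hL2 : MemLp (u : Rn n → ℝ) 2 (volume.restrict (Metric.ball c δ)) :=
      (memLp_two u).restrict _
    have h1 := mul_sq_sub_average_le hL2 hbpos (by simp [hvolr]) (u x)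
    have hi : Integrable (fun y => (u x - u y) ^ 2) (volume.restrict (Metric.ball c δ)) :=
      ((memLp_const (u x)).sub hL2).integrable_sq
    have h2 := ENNReal.ofReal_le_ofReal h1
    rw [ofReal_integral_eq_lintegral_ofReal hi (Eventually.of_forall fun y => sq_nonneg _)] at h2
    have h3 := h2.trans (setLIntegral_ball_le hs hxc)
    have h4 : u x ^ 2 ≤ (2 * b⁻¹) * (b * (u x - m c) ^ 2) + 2 * m c ^ 2 := by
      have : (2 * b⁻¹) * (b * (u x - m c) ^ 2) = 2 * (u x - m c) ^ 2 := by field_simp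
      rw [this]
      nlinarith [sq_nonneg (u x - 2 * m c)]
    have h5 : 2 * m c ^ 2 ≤ σ :=
      Finset.single_le_sum (f := fun c => 2 * m c ^ 2) (fun c _ => by positivity)
        (htfin.mem_toFinset.2 hct)
    have h6 : 2 * b⁻¹ * (2 * δ) ^ ((n : ℝ) + 2 * s) = B / A * δ ^ (2 * s) := by
      rw [Real.mul_rpow (by norm_num) hδ.le, Real.rpow_add hδ, Real.rpow_natCast, hB, hb]
      field_simp
    calc ENNReal.ofReal (u x ^ 2)
        ≤ ENNReal.ofReal ((2 * b⁻¹) * (b * (u x - m c) ^ 2) + σ) :=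
          ENNReal.ofReal_le_ofReal (by linarith)
      _ ≤ ENNReal.ofReal ((2 * b⁻¹) * (b * (u x - m c) ^ 2)) + ENNReal.ofReal σ :=
          ENNReal.ofReal_add_le
      _ ≤ _ := by
          rw [← h6, ENNReal.ofReal_mul (by positivity),
            ENNReal.ofReal_mul (p := 2 * b⁻¹) (q := (2 * δ) ^ ((n : ℝ) + 2 * s)) (by positivity),
            mul_assoc (ENNReal.ofReal (2 * b⁻¹))]
          exact add_le_add_left (mul_le_mul_right h3 _) _
  have hfin : volume Ω ≠ ⊤ := (volume_lt_top h).ne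
  have hint : ENNReal.ofReal (‖toL2 h u‖ ^ 2)
      ≤ ENNReal.ofReal (B / A * δ ^ (2 * s) * (A * ‖u‖ ^ 2) + V * σ) := by
    rw [norm_toL2_sq, ofReal_integral_eq_lintegral_ofReal
      ((memLp_two u).integrable_sq.integrableOn) (Eventually.of_forall fun x => sq_nonneg _)]
    refine (setLIntegral_mono' h.isOpen.measurableSet hpt).trans ?_
    rw [lintegral_add_right _ measurable_const, lintegral_const_mul' _ _ ENNReal.ofReal_ne_top,
      setLIntegral_const, ENNReal.ofReal_add (by positivity) (by positivity),
      ENNReal.ofReal_mul (p := B / A * δ ^ (2 * s)) (by positivity), mul_comm V,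
      ENNReal.ofReal_mul hσ0, hV, ofReal_measureReal hfin]
    gcongr
    exact (setLIntegral_le_lintegral _ _).trans (hG u)
  rw [ENNReal.ofReal_le_ofReal_iff (by positivity)] at hint
  refine hint.trans (add_le_add_left ?_ _)
  have : B / A * δ ^ (2 * s) * (A * ‖u‖ ^ 2) = B * δ ^ (2 * s) * ‖u‖ ^ 2 := by field_simp
  rw [this]
  gcongr

/-- The embedding of `X₀` into `L²` is compact: a diagonal subsequence makes all the countably many
functionals of the Ehrling-type inequalities converge. -/
theorem exists_subseq_toL2_tendsto {u : ℕ → X0 h} {R : ℝ} (hR : ∀ j, ‖u j‖ ≤ R) :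
    ∃ k : ℕ → ℕ, StrictMono k ∧ ∃ w, Tendsto (fun i => toL2 h (u (k i))) atTop (𝓝 w) := by
  have hε : ∀ m : ℕ, (0 : ℝ) < 1 / ((m : ℝ) + 1) := fun m => by positivity
  choose t e hte using fun m : ℕ => exists_norm_toL2_sq_le h (hε m)
  have hR0 : 0 ≤ R := (norm_nonneg _).trans (hR 0)
  let I := Σ m : ℕ, t m
  let x : ℕ → I → ℝ := fun j i => inner ℝ (e i.1 i.2) (toL2 h (u j))
  have hx : ∀ j, x j ∈ Set.pi univ fun i : I =>
      Metric.closedBall (0 : ℝ) (‖e i.1 i.2‖ * (‖toL2 h‖ * R)) := by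
    intro j i _
    rw [mem_closedBall_zero_iff]
    refine (norm_inner_le_norm _ _).trans ?_
    gcongr
    exact ((toL2 h).le_opNorm _).trans (by gcongr; exact hR j)
  obtain ⟨a, -, k, hk, hka⟩ := (isCompact_univ_pi fun i : I =>
    isCompact_closedBall (0 : ℝ) (‖e i.1 i.2‖ * (‖toL2 h‖ * R))).tendsto_subseq hx
  refine ⟨k, hk, cauchySeq_tendsto_of_complete ?_⟩
  rw [Metric.cauchySeq_iff]
  intro η hη
  obtain ⟨m, hm⟩ := exists_nat_one_div_lt (show 0 < η ^ 2 / 2 / ((2 * R) ^ 2 + 1) by positivity)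
  have hcau : ∀ c : t m, ∃ N, ∀ i ≥ N, ∀ j ≥ N,
      (x (k i) ⟨m, c⟩ - x (k j) ⟨m, c⟩) ^ 2 < η ^ 2 / 2 / ((t m).card + 1) := by
    intro c
    have h1 : CauchySeq fun i => x (k i) ⟨m, c⟩ := (tendsto_pi_nhds.1 hka ⟨m, c⟩).cauchySeq
    obtain ⟨N, hN⟩ := Metric.cauchySeq_iff.1 h1 (√(η ^ 2 / 2 / ((t m).card + 1))) (by positivity)
    refine ⟨N, fun i hi j hj => ?_⟩
    have := hN i hi j hj
    rw [Real.dist_eq] at this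
    rw [← sq_abs]
    exact (Real.lt_sqrt (abs_nonneg _)).1 this
  choose N hN using hcau
  refine ⟨Finset.univ.sup N, fun i hi j hj => ?_⟩
  have h1 := hte m (u (k i) - u (k j))
  have h2 : ∑ c ∈ t m, (inner ℝ (e m c) (toL2 h (u (k i) - u (k j)))) ^ 2 ≤ η ^ 2 / 2 := by
    calc _ ≤ ∑ c ∈ t m, η ^ 2 / 2 / ((t m).card + 1) := by
          refine Finset.sum_le_sum fun c hc => ?_
          have := hN ⟨c, hc⟩ i ((Finset.le_sup (Finset.mem_univ _)).trans hi) j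
            ((Finset.le_sup (Finset.mem_univ _)).trans hj)
          rw [map_sub, inner_sub_right]
          exact this.le
      _ ≤ η ^ 2 / 2 := by
          rw [Finset.sum_const, nsmul_eq_mul, mul_div_assoc', div_le_iff₀ (by positivity)]
          nlinarith [sq_nonneg η]
  have h3 : 1 / ((m : ℝ) + 1) * ‖u (k i) - u (k j)‖ ^ 2 < η ^ 2 / 2 := by
    have h4 : ‖u (k i) - u (k j)‖ ≤ 2 * R := by
      refine (norm_sub_le _ _).trans ?_
      linarith [hR (k i), hR (k j)]
    calc _ ≤ 1 / ((m : ℝ) + 1) * (2 * R) ^ 2 := by gcongr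
      _ ≤ 1 / ((m : ℝ) + 1) * ((2 * R) ^ 2 + 1) := by gcongr; linarith
      _ < _ := by rwa [← lt_div_iff₀ (by positivity)]
  rw [dist_eq_norm, ← map_sub]
  exact lt_of_pow_lt_pow_left₀ 2 hη.le (by linarith)

end X0

/-! ### Differentiability of the nonlinear term -/

/-- A continuous nonlinearity whose growth on `Ω` is strictly below the power `P - 1`, uniformly
in `x`. -/
structure IsSubcritical {n : ℕ} (P : ℝ) (Ω : Set (Rn n)) (f : Rn n → ℝ → ℝ) : Prop where
  continuous : Continuous (Function.uncurry f)
  growth : ∀ ε > 0, ∃ C ≥ 0, ∀ x ∈ Ω, ∀ t : ℝ, |f x t| ≤ C + ε * |t| ^ (P - 1)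

theorem SubcriticalGrowth.isSubcritical {n : ℕ} {s : ℝ} {Ω : Set (Rn n)} {f : Rn n → ℝ → ℝ}
    (hf : SubcriticalGrowth s Ω f) (hc : Continuous (Function.uncurry f)) :
    IsSubcritical (critExp n s) Ω f := by
  refine ⟨hc, fun ε hε => ?_⟩
  obtain ⟨a₁, ha₁, a₂, ha₂, q, hq, hqP, hb⟩ := hf
  change q < critExp n s at hqP
  set P := critExp n s
  set M := (a₂ / ε) ^ (1 / (P - q)) with hM
  have hMpos : 0 < M := by positivity
  have hMq : a₂ = ε * M ^ (P - q) := by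
    rw [hM, ← Real.rpow_mul (by positivity), one_div_mul_cancel (by linarith), Real.rpow_one]
    field_simp
  refine ⟨a₁ + a₂ * M ^ (q - 1), by positivity, fun x hx t => (hb x hx t).trans ?_⟩
  have hnn : 0 ≤ ε * |t| ^ (P - 1) := by positivity
  rcases le_total |t| M with htM | htM
  · have h1 : |t| ^ (q - 1) ≤ M ^ (q - 1) :=
      Real.rpow_le_rpow (abs_nonneg t) htM (by linarith)
    nlinarith
  · have ht : 0 < |t| := hMpos.trans_le htM
    have h1 : M ^ (P - q) ≤ |t| ^ (P - q) := Real.rpow_le_rpow hMpos.le htM (by linarith)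
    have h2 : |t| ^ (P - 1) = |t| ^ (P - q) * |t| ^ (q - 1) := by
      rw [← Real.rpow_add ht]; congr 1; ring
    have h3 : a₂ * |t| ^ (q - 1) ≤ ε * |t| ^ (P - 1) := by
      rw [h2, ← mul_assoc]
      refine mul_le_mul_of_nonneg_right ?_ (by positivity)
      rw [hMq]
      gcongr
    have h4 : 0 ≤ a₂ * M ^ (q - 1) := by positivity
    linarith

theorem rpow_sub_one_mul_self {P a : ℝ} (hP : 1 < P) (ha : 0 ≤ a) : a ^ (P - 1) * a = a ^ P := by
  rw [← Real.rpow_add_one' ha (by linarith), sub_add_cancel]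

theorem rpow_sub_one_mul_le {P a b : ℝ} (hP : 1 < P) (ha : 0 ≤ a) (hb : 0 ≤ b) :
    a ^ (P - 1) * b ≤ a ^ P + b ^ P := by
  have h1 : 0 ≤ a ^ P := by positivity
  have h2 : 0 ≤ b ^ P := by positivity
  rcases le_total b a with h | h
  · have := mul_le_mul_of_nonneg_left h (Real.rpow_nonneg ha (P - 1))
    rw [rpow_sub_one_mul_self hP ha] at this
    linarith
  · have := mul_le_mul_of_nonneg_right (Real.rpow_le_rpow ha h (by linarith : 0 ≤ P - 1)) hb
    rw [rpow_sub_one_mul_self hP hb] at this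
    linarith

theorem abs_add_rpow_le {p : ℝ} (hp : 0 ≤ p) (a b : ℝ) :
    |a + b| ^ p ≤ 2 ^ p * (|a| ^ p + |b| ^ p) := by
  have h1 : |a + b| ≤ 2 * max |a| |b| := by
    have := abs_add_le a b
    have h2 := le_max_left |a| |b|
    have h3 := le_max_right |a| |b|
    linarith
  refine (Real.rpow_le_rpow (abs_nonneg _) h1 hp).trans ?_
  rw [Real.mul_rpow (by norm_num) (by positivity)]
  refine mul_le_mul_of_nonneg_left ?_ (by positivity)
  have ha : 0 ≤ |a| ^ p := by positivity
  have hb : 0 ≤ |b| ^ p := by positivity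
  rcases le_total |a| |b| with h | h
  · rw [max_eq_right h]; linarith
  · rw [max_eq_left h]; linarith

section Pointwise

variable {n : ℕ} {P : ℝ} {Ω : Set (Rn n)} {f : Rn n → ℝ → ℝ}

/-- The increments of a subcritical nonlinearity: uniform continuity is used where `t` is bounded
and `τ` small, and the growth bound elsewhere. -/
theorem IsSubcritical.exists_abs_sub_le (hf : IsSubcritical P Ω f) (hP : 2 < P)
    (hΩ : Bornology.IsBounded Ω) {ε : ℝ} (hε : 0 < ε) :
    ∃ C ≥ 0, ∀ x ∈ Ω, ∀ t τ : ℝ,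
      |f x (t + τ) - f x t| ≤ ε * (1 + |t| ^ (P - 1)) + C * |τ| ^ (P - 1) := by
  have hp : 0 < P - 1 := by linarith
  set c := (2 : ℝ) ^ (P - 1) with hc
  have hcpos : 0 < c := by positivity
  set ε₁ := ε / (2 * (c + 1)) with hε₁
  have hε₁pos : 0 < ε₁ := by positivity
  have hεε : ε₁ * (c + 1) = ε / 2 := by rw [hε₁]; field_simp
  obtain ⟨C₁, hC₁, hgr⟩ := hf.growth ε₁ hε₁pos
  set M := (4 * C₁ / ε) ^ (1 / (P - 1)) with hM
  have hM0 : 0 ≤ M := by positivity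
  have hMp : M ^ (P - 1) = 4 * C₁ / ε := by
    rw [hM, ← Real.rpow_mul (by positivity), one_div_mul_cancel hp.ne', Real.rpow_one]
  have hcomp : IsCompact (closure Ω ×ˢ Icc (-(M + 1)) (M + 1)) :=
    hΩ.isCompact_closure.prod isCompact_Icc
  obtain ⟨δ', hδ', hunif⟩ := Metric.uniformContinuousOn_iff.1
    (hcomp.uniformContinuousOn_of_continuous hf.continuous.continuousOn) ε hε
  set δ := min δ' 1 with hδdef
  have hδ : 0 < δ := lt_min hδ' one_pos
  refine ⟨2 * C₁ / δ ^ (P - 1) + ε₁ * c, by positivity, fun x hx t τ => ?_⟩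
  have ht0 : 0 ≤ |t| ^ (P - 1) := by positivity
  have hτ0 : 0 ≤ |τ| ^ (P - 1) := by positivity
  by_cases hcase : |t| ≤ M ∧ |τ| < δ
  · obtain ⟨htM, hτδ⟩ := hcase
    have hτ1 : |τ| < 1 := hτδ.trans_le (min_le_right _ _)
    rw [abs_le] at htM
    rw [abs_lt] at hτ1
    have h1 := hunif (x, t + τ) ⟨subset_closure hx, by constructor <;> linarith⟩
      (x, t) ⟨subset_closure hx, by constructor <;> linarith⟩
      (by
        rw [Prod.dist_eq, dist_self, Real.dist_eq, add_sub_cancel_left]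
        exact max_lt hδ' (hτδ.trans_le (min_le_left _ _)))
    rw [Real.dist_eq] at h1
    have h2 : 0 ≤ ε * |t| ^ (P - 1) := by positivity
    have h3 : 0 ≤ (2 * C₁ / δ ^ (P - 1) + ε₁ * c) * |τ| ^ (P - 1) := by positivity
    refine h1.le.trans ?_
    linarith
  · have hlarge : 2 * C₁ ≤ ε / 2 * |t| ^ (P - 1) + 2 * C₁ / δ ^ (P - 1) * |τ| ^ (P - 1) := by
      rw [not_and_or, not_le, not_lt] at hcase
      rcases hcase with h1 | h1
      · have h2 : M ^ (P - 1) ≤ |t| ^ (P - 1) := Real.rpow_le_rpow hM0 h1.le hp.le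
        rw [hMp, div_le_iff₀ hε] at h2
        have : 0 ≤ 2 * C₁ / δ ^ (P - 1) * |τ| ^ (P - 1) := by positivity
        linarith
      · have h2 : δ ^ (P - 1) ≤ |τ| ^ (P - 1) := Real.rpow_le_rpow hδ.le h1 hp.le
        have h3 : 2 * C₁ ≤ 2 * C₁ / δ ^ (P - 1) * |τ| ^ (P - 1) := by
          rw [div_mul_eq_mul_div, le_div_iff₀ (by positivity)]
          gcongr
        have : 0 ≤ ε / 2 * |t| ^ (P - 1) := by positivity
        linarith
    have h1 := hgr x hx (t + τ)
    have h2 := hgr x hx t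
    have h3 := mul_le_mul_of_nonneg_left (abs_add_rpow_le hp.le t τ) hε₁pos.le
    have h4 := abs_sub (f x (t + τ)) (f x t)
    have h5 : ε₁ * (2 ^ (P - 1) * (|t| ^ (P - 1) + |τ| ^ (P - 1))) + ε₁ * |t| ^ (P - 1)
        = ε / 2 * |t| ^ (P - 1) + ε₁ * c * |τ| ^ (P - 1) := by
      rw [← hεε, ← hc]; ring
    linarith

theorem continuous_primitive (hc : Continuous (Function.uncurry f)) :
    Continuous (Function.uncurry (primitive f)) :=
  intervalIntegral.continuous_parametric_primitive_of_continuous hc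

theorem hasDerivAt_primitive (hc : Continuous (Function.uncurry f)) (x : Rn n) (t : ℝ) :
    HasDerivAt (primitive f x) (f x t) t := by
  have h1 : Continuous (f x) := hc.comp (Continuous.prodMk_right x)
  exact intervalIntegral.integral_hasDerivAt_right (h1.intervalIntegrable _ _)
    (h1.stronglyMeasurableAtFilter _ _) h1.continuousAt

theorem abs_primitive_sub_le (hc : Continuous (Function.uncurry f)) {x : Rn n} {t τ B : ℝ}
    (hB : ∀ σ, |σ| ≤ |τ| → |f x (t + σ) - f x t| ≤ B) :
    |primitive f x (t + τ) - primitive f x t - f x t * τ| ≤ B * |τ| := by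
  have h1 : Continuous (f x) := hc.comp (Continuous.prodMk_right x)
  have e1 : primitive f x (t + τ) - primitive f x t - f x t * τ
      = ∫ y in t..(t + τ), (f x y - f x t) := by
    rw [intervalIntegral.integral_sub (h1.intervalIntegrable _ _) (by simp), primitive, primitive,
      intervalIntegral.integral_interval_sub_left (h1.intervalIntegrable _ _)
        (h1.intervalIntegrable _ _)]
    simp
    ring
  rw [e1]
  have h2 := intervalIntegral.norm_integral_le_of_norm_le_const (a := t) (b := t + τ) (C := B)
    (f := fun y => f x y - f x t) (fun y hy => by
      have h3 : |y - t| ≤ |τ| := by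
        have := Set.abs_sub_left_of_mem_uIcc (uIoc_subset_uIcc hy)
        simpa using this
      have := hB (y - t) h3
      rwa [add_sub_cancel] at this)
  simpa using h2

theorem IsSubcritical.exists_abs_primitive_le (hf : IsSubcritical P Ω f) (hP : 2 < P) {ε : ℝ}
    (hε : 0 < ε) :
    ∃ C ≥ 0, ∀ x ∈ Ω, ∀ t : ℝ, |primitive f x t| ≤ C * |t| + ε * |t| ^ P := by
  obtain ⟨C, hC, hgr⟩ := hf.growth ε hε
  refine ⟨C, hC, fun x hx t => ?_⟩
  have h2 := intervalIntegral.norm_integral_le_of_norm_le_const (a := 0) (b := t)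
    (C := C + ε * |t| ^ (P - 1)) (f := f x) (fun y hy => by
      have h3 : |y| ≤ |t| := by
        have := Set.abs_sub_left_of_mem_uIcc (uIoc_subset_uIcc hy)
        simpa using this
      refine (hgr x hx y).trans ?_
      gcongr
      linarith)
  rw [sub_zero] at h2
  calc |primitive f x t| ≤ (C + ε * |t| ^ (P - 1)) * |t| := h2
    _ = C * |t| + ε * (|t| ^ (P - 1) * |t|) := by ring
    _ = _ := by rw [rpow_sub_one_mul_self (by linarith) (abs_nonneg t)]

end Pointwise

namespace X0

variable {n : ℕ} {s : ℝ} {Ω : Set (Rn n)} {K : Rn n → ℝ} {h : StandingAssumptions s Ω K}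
  {f : Rn n → ℝ → ℝ}

theorem isFiniteMeasure_restrict (h : StandingAssumptions s Ω K) :
    IsFiniteMeasure (volume.restrict Ω) := ⟨by simpa using volume_lt_top h⟩

theorem integrable_rpow (u : X0 h) : Integrable fun x => |u x| ^ critExp n s :=
  (exists_integral_rpow_le h).choose_spec.2 u |>.1

theorem integrableOn_abs (u : X0 h) : IntegrableOn (fun x => |u x|) Ω := by
  have := isFiniteMeasure_restrict h
  exact (((memLp_two u).restrict Ω).integrable (by norm_num)).abs

theorem integrable_rpow_mul (u φ : X0 h) :
    Integrable fun x => |u x| ^ (critExp n s - 1) * |φ x| := by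
  have hu := measurable_coe u
  have hφ := measurable_coe φ
  have hP := two_lt_critExp h.s_pos h.two_s_lt
  refine ((integrable_rpow u).add (integrable_rpow φ)).mono'
    (Measurable.aestronglyMeasurable (by fun_prop)) (Eventually.of_forall fun x => ?_)
  rw [Real.norm_of_nonneg (by positivity)]
  exact rpow_sub_one_mul_le (by linarith) (abs_nonneg _) (abs_nonneg _)

theorem integrableOn_one_add_rpow_mul (u φ : X0 h) :
    IntegrableOn (fun x => (1 + |u x| ^ (critExp n s - 1)) * |φ x|) Ω := by
  simp_rw [add_mul, one_mul]
  exact (integrableOn_abs φ).add (integrable_rpow_mul u φ).integrableOn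

/-- Linear control in `‖φ‖`, by Young's inequality applied to `φ / ‖φ‖`. -/
theorem exists_integral_one_add_rpow_mul_le (h : StandingAssumptions s Ω K) :
    ∃ C : ℝ, 0 < C ∧ ∀ u φ : X0 h, ∫ x in Ω, (1 + |u x| ^ (critExp n s - 1)) * |φ x|
      ≤ C * (1 + ‖u‖ ^ critExp n s) * ‖φ‖ := by
  obtain ⟨C, hC, hsob⟩ := exists_integral_rpow_le h
  have hP := two_lt_critExp h.s_pos h.two_s_lt
  have := isFiniteMeasure_restrict h
  refine ⟨volume.real Ω + 2 * C, by positivity, fun u φ => ?_⟩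
  set P := critExp n s
  rcases (norm_nonneg φ).eq_or_lt with h0 | hρ
  · have h00 : (toAEEqFun (0 : X0 h) : Rn n → ℝ) =ᵐ[volume] 0 := AEEqFun.coeFn_zero
    rw [← h0, norm_eq_zero.1 h0.symm]
    refine (integral_eq_zero_of_ae ?_).trans_le (by simp)
    filter_upwards [ae_restrict_of_ae h00] with x hx
    simp [hx]
  have hpt : ∀ x, (1 + |u x| ^ (P - 1)) * |φ x|
      ≤ ‖φ‖ * (1 + (|u x| ^ P + 2 * ((‖φ‖ ^ P)⁻¹ * |φ x| ^ P))) := by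
    intro x
    have h1 := rpow_sub_one_mul_le (P := P) (by linarith) zero_le_one
      (show 0 ≤ |φ x| / ‖φ‖ by positivity)
    have h2 := rpow_sub_one_mul_le (P := P) (by linarith) (abs_nonneg (u x))
      (show 0 ≤ |φ x| / ‖φ‖ by positivity)
    rw [Real.div_rpow (abs_nonneg _) hρ.le, div_eq_inv_mul (_ ^ P)] at h1 h2
    rw [Real.one_rpow, Real.one_rpow, one_mul] at h1
    have h3 := mul_le_mul_of_nonneg_left (add_le_add h1 h2) hρ.le
    have e : ‖φ‖ * (|φ x| / ‖φ‖ + |u x| ^ (P - 1) * (|φ x| / ‖φ‖))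
        = (1 + |u x| ^ (P - 1)) * |φ x| := by field_simp
    rw [e] at h3
    refine h3.trans_eq ?_
    ring
  have i1 : IntegrableOn (fun x => |u x| ^ P) Ω := (integrable_rpow u).integrableOn
  have i2 : IntegrableOn (fun x => 2 * ((‖φ‖ ^ P)⁻¹ * |φ x| ^ P)) Ω :=
    (((integrable_rpow φ).const_mul _).const_mul _).integrableOn
  have i3 : IntegrableOn (fun x => |u x| ^ P + 2 * ((‖φ‖ ^ P)⁻¹ * |φ x| ^ P)) Ω := i1.add i2
  have hz : ∀ (u : X0 h) (x : Rn n), u x = 0 → |u x| ^ P = 0 := fun u x hx => by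
    rw [hx, abs_zero, Real.zero_rpow (by linarith)]
  have i4 : IntegrableOn (fun x => ‖φ‖ * (1 + (|u x| ^ P + 2 * ((‖φ‖ ^ P)⁻¹ * |φ x| ^ P)))) Ω :=
    ((integrable_const _).add i3).const_mul _
  refine (setIntegral_mono (integrableOn_one_add_rpow_mul u φ) i4 hpt).trans ?_
  rw [integral_const_mul, integral_add (integrable_const _) i3, integral_add i1 i2,
    integral_const_mul, integral_const_mul,
    setIntegral_eq_integral u (g := fun x => |u x| ^ P) (hz u),
    setIntegral_eq_integral φ (g := fun x => |φ x| ^ P) (hz φ), mul_comm]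
  refine mul_le_mul_of_nonneg_right ?_ hρ.le
  have h3 : (‖φ‖ ^ P)⁻¹ * ∫ x, |φ x| ^ P ≤ C := by
    rw [inv_mul_le_iff₀ (by positivity), mul_comm]
    exact (hsob φ).2
  have h4 := (hsob u).2
  have h5 : 0 ≤ ‖u‖ ^ P := by positivity
  have h6 : 0 ≤ volume.real Ω := measureReal_nonneg
  rw [integral_const, smul_eq_mul, measureReal_restrict_apply_univ, mul_one]
  nlinarith [mul_nonneg h6 h5, mul_nonneg hC.le h5]

theorem aestronglyMeasurable_comp {g : Rn n → ℝ → ℝ} (hg : Continuous (Function.uncurry g))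
    (u : X0 h) {ν : Measure (Rn n)} : AEStronglyMeasurable (fun x => g x (u x)) ν :=
  (hg.measurable.comp (measurable_id.prodMk (measurable_coe u))).aestronglyMeasurable

theorem ae_mem (h : StandingAssumptions s Ω K) : ∀ᵐ x ∂(volume.restrict Ω), x ∈ Ω :=
  ae_restrict_mem h.isOpen.measurableSet

theorem integrableOn_primitive (hf : IsSubcritical (critExp n s) Ω f) (u : X0 h) :
    IntegrableOn (fun x => primitive f x (u x)) Ω := by
  obtain ⟨C, hC, hb⟩ :=
    hf.exists_abs_primitive_le (two_lt_critExp h.s_pos h.two_s_lt) one_pos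
  refine Integrable.mono' (((integrableOn_abs u).const_mul C).add
    ((integrable_rpow u).const_mul 1).integrableOn)
    (aestronglyMeasurable_comp (continuous_primitive hf.continuous) u) ?_
  filter_upwards [ae_mem h] with x hx
  exact hb x hx _

theorem exists_abs_comp_mul_le (hf : IsSubcritical (critExp n s) Ω f) :
    ∃ C > 0, ∀ x ∈ Ω, ∀ t τ : ℝ,
      |f x t * τ| ≤ C * ((1 + |t| ^ (critExp n s - 1)) * |τ|) := by
  obtain ⟨C, hC, hgr⟩ := hf.growth 1 one_pos
  refine ⟨C + 1, by positivity, fun x hx t τ => ?_⟩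
  rw [abs_mul, ← mul_assoc]
  refine mul_le_mul_of_nonneg_right ((hgr x hx t).trans ?_) (abs_nonneg τ)
  have : 0 ≤ |t| ^ (critExp n s - 1) := by positivity
  nlinarith

theorem integrableOn_comp_mul (hf : IsSubcritical (critExp n s) Ω f) (u φ : X0 h) :
    IntegrableOn (fun x => f x (u x) * φ x) Ω := by
  obtain ⟨C, -, hb⟩ := exists_abs_comp_mul_le hf
  refine Integrable.mono' ((integrableOn_one_add_rpow_mul u φ).const_mul C)
    ((aestronglyMeasurable_comp hf.continuous u).mul
      (measurable_coe φ).aestronglyMeasurable) ?_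
  filter_upwards [ae_mem h] with x hx
  exact hb x hx _ _

/-- The linear form `φ ↦ ∫_Ω f(x, u) φ` on `X₀`. -/
def nonlinearForm (hf : IsSubcritical (critExp n s) Ω f) (u : X0 h) : X0 h →L[ℝ] ℝ :=
  LinearMap.mkContinuousOfExistsBound
    { toFun := fun φ => ∫ x in Ω, f x (u x) * φ x
      map_add' := fun φ ψ => by
        rw [← integral_add (integrableOn_comp_mul hf u φ) (integrableOn_comp_mul hf u ψ)]
        refine integral_congr_ae ?_
        filter_upwards [ae_restrict_of_ae (coe_add φ ψ)] with x hx
        rw [hx]; ring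
      map_smul' := fun c φ => by
        rw [RingHom.id_apply, smul_eq_mul, ← integral_const_mul]
        refine integral_congr_ae ?_
        filter_upwards [ae_restrict_of_ae (coe_smul c φ)] with x hx
        rw [hx]; ring }
    (by
      obtain ⟨C, hC, hb⟩ := exists_abs_comp_mul_le hf
      obtain ⟨D, hD, hint⟩ := exists_integral_one_add_rpow_mul_le h
      refine ⟨C * (D * (1 + ‖u‖ ^ critExp n s)), fun φ => ?_⟩
      have h1 : ‖∫ x in Ω, f x (u x) * φ x‖
          ≤ ∫ x in Ω, C * ((1 + |u x| ^ (critExp n s - 1)) * |φ x|) := by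
        refine norm_integral_le_of_norm_le ((integrableOn_one_add_rpow_mul u φ).const_mul C) ?_
        filter_upwards [ae_mem h] with x hx
        exact hb x hx _ _
      rw [integral_const_mul] at h1
      refine h1.trans ?_
      rw [mul_assoc]
      exact mul_le_mul_of_nonneg_left (hint u φ) hC.le)

theorem nonlinearForm_apply (hf : IsSubcritical (critExp n s) Ω f) (u φ : X0 h) :
    nonlinearForm hf u φ = ∫ x in Ω, f x (u x) * φ x := rfl

theorem hasFDerivAt_integral_primitive (hf : IsSubcritical (critExp n s) Ω f) (u : X0 h) :
    HasFDerivAt (fun v : X0 h => ∫ x in Ω, primitive f x (v x)) (nonlinearForm hf u) u := by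
  have hP := two_lt_critExp h.s_pos h.two_s_lt
  rw [hasFDerivAt_iff_isLittleO_nhds_zero, Asymptotics.isLittleO_iff]
  intro c hc
  obtain ⟨D, hD, hint⟩ := exists_integral_one_add_rpow_mul_le h
  obtain ⟨S, hS, hsob⟩ := exists_integral_rpow_le h
  set P := critExp n s with hPdef
  set B := D * (1 + ‖u‖ ^ P) with hB
  have hBpos : 0 < B := by positivity
  obtain ⟨C, hC, hinc⟩ := hf.exists_abs_sub_le hP h.isBounded
    (show 0 < c / (2 * B) by positivity)
  have hsmall : ∀ᶠ φ : X0 h in 𝓝 0, C * S * ‖φ‖ ^ (P - 1) < c / 2 := by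
    have h1 : ContinuousAt (fun φ : X0 h => C * S * ‖φ‖ ^ (P - 1)) 0 :=
      continuousAt_const.mul (continuous_norm.continuousAt.rpow_const (Or.inr (by linarith)))
    have h2 : C * S * ‖(0 : X0 h)‖ ^ (P - 1) < c / 2 := by
      rw [norm_zero, Real.zero_rpow (by linarith), mul_zero]
      positivity
    exact h1.eventually_lt continuousAt_const h2
  filter_upwards [hsmall] with φ hφ
  have e : ∀ a : ℝ, 0 ≤ a → a ^ (P - 1) * a = a ^ P := fun a =>
    rpow_sub_one_mul_self (by linarith)
  have i1 := (integrableOn_one_add_rpow_mul u φ).const_mul (c / (2 * B))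
  have i2 : IntegrableOn (fun x => C * |φ x| ^ P) Ω :=
    ((integrable_rpow φ).const_mul C).integrableOn
  have i3 : IntegrableOn
      (fun x => primitive f x ((u + φ : X0 h) x) - primitive f x (u x)) Ω :=
    (integrableOn_primitive hf _).sub (integrableOn_primitive hf _)
  have h1 : ‖(∫ x in Ω, primitive f x ((u + φ : X0 h) x)) - (∫ x in Ω, primitive f x (u x))
      - nonlinearForm hf u φ‖
      ≤ ∫ x in Ω, (c / (2 * B) * ((1 + |u x| ^ (P - 1)) * |φ x|) + C * |φ x| ^ P) := by
    rw [nonlinearForm_apply, ← integral_sub (integrableOn_primitive hf _)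
      (integrableOn_primitive hf _), ← integral_sub i3 (integrableOn_comp_mul hf u φ)]
    refine norm_integral_le_of_norm_le (i1.add i2) ?_
    filter_upwards [ae_mem h, ae_restrict_of_ae (coe_add u φ)] with x hx hadd
    rw [hadd, Real.norm_eq_abs]
    refine (abs_primitive_sub_le hf.continuous
      (B := c / (2 * B) * (1 + |u x| ^ (P - 1)) + C * |φ x| ^ (P - 1)) fun σ hσ => ?_).trans_eq ?_
    · refine (hinc x hx (u x) σ).trans ?_
      gcongr
      linarith
    · rw [add_mul, mul_assoc, mul_assoc, e _ (abs_nonneg _)]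
  refine h1.trans ?_
  rw [integral_add i1 i2, integral_const_mul, integral_const_mul,
    setIntegral_eq_integral φ (g := fun x => |φ x| ^ P) (fun x hx => by
      rw [hx, abs_zero, Real.zero_rpow (by linarith)])]
  have h2 : c / (2 * B) * ∫ x in Ω, (1 + |u x| ^ (P - 1)) * |φ x| ≤ c / 2 * ‖φ‖ := by
    refine (mul_le_mul_of_nonneg_left (hint u φ) (by positivity)).trans_eq ?_
    rw [← hB]
    field_simp
  have h3 : C * ∫ x, |φ x| ^ P ≤ c / 2 * ‖φ‖ := by
    refine (mul_le_mul_of_nonneg_left (hsob φ).2 hC).trans ?_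
    rw [← e _ (norm_nonneg φ), ← mul_assoc, ← mul_assoc]
    exact mul_le_mul_of_nonneg_right hφ.le (norm_nonneg φ)
  linarith

end X0

/-! ### Consequences of the Ambrosetti–Rabinowitz condition -/

/-- Integrating `μ Φ ≤ t Φ'` from `r` to `t` gives superquadratic growth of `Φ`. -/
theorem mul_div_rpow_le_of_mul_le_mul_deriv {Φ φ : ℝ → ℝ} {μ r : ℝ} (hr : 0 < r)
    (hΦ : ∀ t, HasDerivAt Φ (φ t) t) (hle : ∀ t, r ≤ t → μ * Φ t ≤ t * φ t) {t : ℝ} (ht : r ≤ t) :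
    Φ r * (t / r) ^ μ ≤ Φ t := by
  have hd : ∀ y, 0 < y → HasDerivAt (fun y => Φ y * y ^ (-μ))
      (φ y * y ^ (-μ) + Φ y * (-μ * y ^ (-μ - 1))) y := fun y hy =>
    (hΦ y).mul (Real.hasDerivAt_rpow_const (Or.inl hy.ne'))
  have hmono : MonotoneOn (fun y => Φ y * y ^ (-μ)) (Ici r) := by
    refine monotoneOn_of_deriv_nonneg (convex_Ici r)
      (fun y hy => (hd y (hr.trans_le hy)).continuousAt.continuousWithinAt) ?_ ?_
    · rw [interior_Ici]
      exact fun y hy => (hd y (hr.trans hy)).differentiableAt.differentiableWithinAt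
    · rw [interior_Ici]
      intro y hy
      have hy0 : 0 < y := hr.trans hy
      rw [(hd y hy0).deriv]
      have e : y ^ (-μ) = y * y ^ (-μ - 1) := by
        rw [mul_comm, ← Real.rpow_add_one hy0.ne', sub_add_cancel]
      rw [e]
      have h1 := mul_nonneg (sub_nonneg.2 (hle y hy.le)) (Real.rpow_nonneg hy0.le (-μ - 1))
      linarith
  have h1 := hmono self_mem_Ici ht ht
  have ht0 : 0 < t := hr.trans_le ht
  simp only [Real.rpow_neg hr.le, Real.rpow_neg ht0.le] at h1
  rw [← div_eq_mul_inv, ← div_eq_mul_inv, le_div_iff₀ (by positivity)] at h1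
  rw [Real.div_rpow ht0.le hr.le]
  calc _ = Φ r / r ^ μ * t ^ μ := by ring
    _ ≤ _ := h1

section Pointwise

variable {n : ℕ} {P : ℝ} {Ω : Set (Rn n)} {f : Rn n → ℝ → ℝ}

/-- On `Ω` the primitive is bounded below by `b x |t|^μ` up to a constant. The weight `b` is positive
on `Ω` but may vanish at the boundary. -/
theorem IsSubcritical.exists_weight (hf : IsSubcritical P Ω f) (hP : 2 < P) {μ r : ℝ}
    (hμ : 2 < μ) (hr : 0 < r) (hAR : ∀ x ∈ Ω, ∀ t : ℝ, r ≤ |t| →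
      0 < μ * primitive f x t ∧ μ * primitive f x t ≤ t * f x t) :
    ∃ b : Rn n → ℝ, Continuous b ∧ (∀ x ∈ Ω, 0 < b x) ∧ ∃ C ≥ 0, ∀ x ∈ Ω, ∀ t : ℝ,
      b x * |t| ^ μ ≤ primitive f x t + C := by
  have hμ0 : 0 < μ := by linarith
  have hFc := continuous_primitive hf.continuous
  have hF : ∀ x ∈ Ω, ∀ t : ℝ, r ≤ |t| → 0 < primitive f x t := fun x hx t ht =>
    pos_of_mul_pos_right (hAR x hx t ht).1 hμ0.le
  obtain ⟨D, hD, hbd⟩ := hf.exists_abs_primitive_le hP one_pos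
  have habs : |(-r)| = r := by rw [abs_neg, abs_of_pos hr]
  set m : Rn n → ℝ := fun x => min (primitive f x r) (primitive f x (-r)) with hm
  have hmpos : ∀ x ∈ Ω, 0 < m x := fun x hx =>
    lt_min (hF x hx r (abs_of_pos hr).ge) (hF x hx (-r) habs.ge)
  refine ⟨fun x => m x * (r ^ μ)⁻¹, ?_, fun x hx => mul_pos (hmpos x hx) (by positivity),
    2 * (D * r + 1 * r ^ P), by positivity, fun x hx t => ?_⟩
  · have h1 : Continuous fun x => primitive f x r := hFc.comp (Continuous.prodMk_left r)
    have h2 : Continuous fun x => primitive f x (-r) := hFc.comp (Continuous.prodMk_left (-r))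
    exact (h1.min h2).mul_const _
  have hmx := hmpos x hx
  have hC : 0 ≤ D * r + 1 * r ^ P := by positivity
  have e : m x * (r ^ μ)⁻¹ * |t| ^ μ = m x * (|t| / r) ^ μ := by
    rw [Real.div_rpow (abs_nonneg t) hr.le]; ring
  rw [e]
  rcases le_total |t| r with htr | htr
  · have h1 : (|t| / r) ^ μ ≤ 1 :=
      Real.rpow_le_one (by positivity) ((div_le_one hr).2 htr) hμ0.le
    have h2 : m x ≤ D * r + 1 * r ^ P := by
      refine (min_le_left _ _).trans ((le_abs_self _).trans ?_)
      have := hbd x hx r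
      rwa [abs_of_pos hr] at this
    have h3 : |primitive f x t| ≤ D * r + 1 * r ^ P := by
      refine (hbd x hx t).trans ?_
      gcongr
    have h4 := neg_abs_le (primitive f x t)
    have h5 : m x * (|t| / r) ^ μ ≤ m x * 1 := mul_le_mul_of_nonneg_left h1 hmx.le
    linarith
  · have key : m x * (|t| / r) ^ μ ≤ primitive f x t := by
      have hnn : 0 ≤ (|t| / r) ^ μ := by positivity
      rcases abs_cases t with ⟨ha, -⟩ | ⟨ha, -⟩
      · have h1 := mul_div_rpow_le_of_mul_le_mul_deriv hr
          (hasDerivAt_primitive hf.continuous x)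
          (fun y hy => (hAR x hx y (hy.trans (le_abs_self y))).2) (ha ▸ htr)
        rw [← ha] at h1
        refine (mul_le_mul_of_nonneg_right (min_le_left _ _) hnn).trans ?_
        rwa [ha] at h1 ⊢
      · have h1 := mul_div_rpow_le_of_mul_le_mul_deriv (Φ := fun y => primitive f x (-y))
          (φ := fun y => -f x (-y)) (μ := μ) hr
          (fun y => by
            have := (hasDerivAt_primitive hf.continuous x (-y)).comp y (hasDerivAt_neg y)
            rwa [mul_neg_one] at this)
          (fun y hy => by
            have := (hAR x hx (-y) (by rw [abs_neg]; exact hy.trans (le_abs_self y))).2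
            linarith) (ha ▸ htr)
        simp only [neg_neg] at h1
        rw [← ha] at h1
        exact (mul_le_mul_of_nonneg_right (min_le_right _ _) hnn).trans h1
    linarith

theorem IsSubcritical.exists_mul_primitive_sub_le (hf : IsSubcritical P Ω f) (hP : 2 < P)
    {μ r : ℝ} (hμ : 2 < μ) (hr : 0 < r) (hAR : ∀ x ∈ Ω, ∀ t : ℝ, r ≤ |t| →
      0 < μ * primitive f x t ∧ μ * primitive f x t ≤ t * f x t) :
    ∃ C ≥ 0, ∀ x ∈ Ω, ∀ t : ℝ, μ * primitive f x t - f x t * t ≤ C := by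
  obtain ⟨D, hD, hbd⟩ := hf.exists_abs_primitive_le hP one_pos
  obtain ⟨E, hE, hgr⟩ := hf.growth 1 one_pos
  refine ⟨μ * (D * r + 1 * r ^ P) + (E + 1 * r ^ (P - 1)) * r, by positivity, fun x hx t => ?_⟩
  rcases le_total |t| r with htr | htr
  · have h1 : |primitive f x t| ≤ D * r + 1 * r ^ P := by
      refine (hbd x hx t).trans ?_
      gcongr
    have h2 : |f x t * t| ≤ (E + 1 * r ^ (P - 1)) * r := by
      rw [abs_mul]
      refine mul_le_mul ((hgr x hx t).trans ?_) htr (abs_nonneg t) (by positivity)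
      have : 0 ≤ P - 1 := by linarith
      gcongr
    have h3 := mul_le_mul_of_nonneg_left ((le_abs_self _).trans h1) (show 0 ≤ μ by linarith)
    have h4 := neg_abs_le (f x t * t)
    linarith
  · have h1 := (hAR x hx t htr).2
    have h2 : 0 ≤ μ * (D * r + 1 * r ^ P) + (E + 1 * r ^ (P - 1)) * r := by positivity
    linarith

end Pointwise

/-! ### The Palais–Smale condition -/

namespace X0

variable {n : ℕ} {s : ℝ} {Ω : Set (Rn n)} {K : Rn n → ℝ} {h : StandingAssumptions s Ω K}
  {f : Rn n → ℝ → ℝ} {lam : ℝ}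

theorem energy_eq (u : X0 h) : energy h f lam u =
    1 / 2 * ‖u‖ ^ 2 - lam / 2 * ‖toL2 h u‖ ^ 2 - ∫ x in Ω, primitive f x (u x) := by
  rw [energy, norm_toL2_sq, norm_sq_def]
  simp only [sq_abs]
  simp only [sq]

/-- The derivative of the energy at `u`. -/
def energyDeriv (hf : IsSubcritical (critExp n s) Ω f) (lam : ℝ) (u : X0 h) : X0 h →L[ℝ] ℝ :=
  innerSL ℝ u - lam • (innerSL ℝ (toL2 h u)).comp (toL2 h) - nonlinearForm hf u

theorem energyDeriv_apply (hf : IsSubcritical (critExp n s) Ω f) (u φ : X0 h) :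
    energyDeriv hf lam u φ = inner ℝ u φ - lam * inner ℝ (toL2 h u) (toL2 h φ)
      - nonlinearForm hf u φ := rfl

theorem hasFDerivAt_energy (hf : IsSubcritical (critExp n s) Ω f) (u : X0 h) :
    HasFDerivAt (energy h f lam) (energyDeriv hf lam u) u := by
  have e : energy h f lam = fun u : X0 h =>
      1 / 2 * ‖u‖ ^ 2 - lam / 2 * ‖toL2 h u‖ ^ 2 - ∫ x in Ω, primitive f x (u x) :=
    funext energy_eq
  rw [e]
  have h1 : HasFDerivAt (fun u : X0 h => ‖u‖ ^ 2) _ u := (hasFDerivAt_id u).norm_sq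
  have h2 : HasFDerivAt (fun u : X0 h => ‖toL2 h u‖ ^ 2) _ u := (toL2 h).hasFDerivAt.norm_sq
  refine (((h1.const_mul (1 / 2)).sub (h2.const_mul (lam / 2))).sub
    (hasFDerivAt_integral_primitive hf u)).congr_fderiv ?_
  ext φ
  simp only [energyDeriv, sub_apply, smul_apply,
    ContinuousLinearMap.comp_apply, innerSL_apply_apply, smul_eq_mul, nsmul_eq_mul]
  simp
  ring

/-- If the norms of a Palais–Smale sequence tended to infinity, the Ambrosetti–Rabinowitz condition
would force the normalised sequence to have a nonzero limit in `L²`, while the superquadratic growth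
of the primitive and Fatou's lemma force this limit to vanish. -/
theorem not_tendsto_norm_atTop (hf : IsSubcritical (critExp n s) Ω f)
    (hAR : AmbrosettiRabinowitz Ω f) {c : ℝ} {u : ℕ → X0 h}
    (hJ : Tendsto (fun j => energy h f lam (u j)) atTop (𝓝 c))
    (hJ' : Tendsto (fun j => ‖energyDeriv hf lam (u j)‖) atTop (𝓝 0)) :
    ¬ Tendsto (fun j => ‖u j‖) atTop atTop := by
  intro hinf
  have hP := two_lt_critExp h.s_pos h.two_s_lt
  have := isFiniteMeasure_restrict h
  obtain ⟨μ, hμ, r, hr, hAR⟩ := hAR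
  obtain ⟨b, hbc, hbpos, C₁, hC₁, hlow⟩ := hf.exists_weight hP hμ hr hAR
  obtain ⟨C₂, hC₂, hup⟩ := hf.exists_mul_primitive_sub_le hP hμ hr hAR
  have hv1 : ∀ j, ‖(‖u j‖⁻¹ • u j : X0 h)‖ ≤ 1 := fun j => by
    rw [norm_smul, norm_inv, norm_norm]
    exact inv_mul_le_one
  obtain ⟨k₁, hk₁, w, hw⟩ := exists_subseq_toL2_tendsto hv1
  obtain ⟨k₂, hk₂, hae⟩ := exists_subseq_tendsto_ae hw
  have hk : Tendsto (fun i => k₁ (k₂ i)) atTop atTop := hk₁.tendsto_atTop.comp hk₂.tendsto_atTop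
  set U : ℕ → X0 h := fun i => u (k₁ (k₂ i)) with hU
  set v : ℕ → X0 h := fun i => ‖U i‖⁻¹ • U i with hv
  replace hJ := hJ.comp hk
  replace hJ' := hJ'.comp hk
  replace hinf := hinf.comp hk
  replace hw : Tendsto (fun i => toL2 h (v i)) atTop (𝓝 w) := hw.comp hk₂.tendsto_atTop
  change Tendsto (fun i => energy h f lam (U i)) atTop (𝓝 c) at hJ
  change Tendsto (fun i => ‖energyDeriv hf lam (U i)‖) atTop (𝓝 0) at hJ'
  change Tendsto (fun i => ‖U i‖) atTop atTop at hinf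
  have hpos : ∀ᶠ i in atTop, 0 < ‖U i‖ := hinf.eventually_gt_atTop 0
  have hinv : Tendsto (fun i => ‖U i‖⁻¹) atTop (𝓝 0) := tendsto_inv_atTop_zero.comp hinf
  have hwn : Tendsto (fun i => ‖toL2 h (v i)‖ ^ 2) atTop (𝓝 (‖w‖ ^ 2)) := hw.norm.pow 2
  have hscale : ∀ i, 0 < ‖U i‖ → ‖toL2 h (U i)‖ ^ 2 = ‖U i‖ ^ 2 * ‖toL2 h (v i)‖ ^ 2 := by
    intro i hi
    have : U i = ‖U i‖ • v i := by rw [hv]; simp only; rw [smul_inv_smul₀ hi.ne']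
    conv_lhs => rw [this, map_smul, norm_smul, norm_norm, mul_pow]
  -- The limit is nonzero.
  have hineq : ∀ i, (μ / 2 - 1) * (‖U i‖ ^ 2 - lam * ‖toL2 h (U i)‖ ^ 2)
      ≤ μ * energy h f lam (U i) + ‖energyDeriv hf lam (U i)‖ * ‖U i‖ + C₂ * volume.real Ω := by
    intro i
    have h1 : -(energyDeriv hf lam (U i) (U i)) ≤ ‖energyDeriv hf lam (U i)‖ * ‖U i‖ :=
      (neg_le_abs _).trans ((energyDeriv hf lam (U i)).le_opNorm (U i))
    have h2 : μ * (∫ x in Ω, primitive f x ((U i) x)) - nonlinearForm hf (U i) (U i)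
        ≤ C₂ * volume.real Ω := by
      rw [nonlinearForm_apply, ← integral_const_mul, ← integral_sub
        ((integrableOn_primitive hf _).const_mul μ) (integrableOn_comp_mul hf _ _)]
      have h3 : ∫ x in Ω, (μ * primitive f x ((U i) x) - f x ((U i) x) * (U i) x)
          ≤ ∫ x in Ω, C₂ := by
        refine integral_mono_ae (((integrableOn_primitive hf _).const_mul μ).sub
          (integrableOn_comp_mul hf _ _)) (integrable_const _) ?_
        filter_upwards [ae_mem h] with x hx
        exact hup x hx _
      refine h3.trans_eq ?_
      rw [integral_const, smul_eq_mul, measureReal_restrict_apply_univ, mul_comm]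
    rw [energyDeriv_apply, real_inner_self_eq_norm_sq, real_inner_self_eq_norm_sq] at h1
    rw [energy_eq]
    linarith
  have hwpos : 1 - lam * ‖w‖ ^ 2 ≤ 0 := by
    have hL : Tendsto (fun i => (μ / 2 - 1) * (1 - lam * ‖toL2 h (v i)‖ ^ 2)) atTop
        (𝓝 ((μ / 2 - 1) * (1 - lam * ‖w‖ ^ 2))) :=
      ((hwn.const_mul lam).const_sub 1).const_mul _
    have hRt : Tendsto (fun i => μ * energy h f lam (U i) * ‖U i‖⁻¹ ^ 2
        + ‖energyDeriv hf lam (U i)‖ * ‖U i‖⁻¹ + C₂ * volume.real Ω * ‖U i‖⁻¹ ^ 2) atTop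
        (𝓝 (μ * c * 0 ^ 2 + 0 * 0 + C₂ * volume.real Ω * 0 ^ 2)) :=
      (((hJ.const_mul μ).mul (hinv.pow 2)).add (hJ'.mul hinv)).add ((hinv.pow 2).const_mul _)
    have hle := le_of_tendsto_of_tendsto hL hRt (by
      filter_upwards [hpos] with i hi
      have h1 := hineq i
      rw [hscale i hi] at h1
      have h2 := mul_le_mul_of_nonneg_right h1 (show 0 ≤ ‖U i‖⁻¹ ^ 2 by positivity)
      have e1 : (μ / 2 - 1) * (‖U i‖ ^ 2 - lam * (‖U i‖ ^ 2 * ‖toL2 h (v i)‖ ^ 2)) * ‖U i‖⁻¹ ^ 2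
          = (μ / 2 - 1) * (1 - lam * ‖toL2 h (v i)‖ ^ 2) := by field_simp
      have e2 : ‖energyDeriv hf lam (U i)‖ * ‖U i‖ * ‖U i‖⁻¹ ^ 2
          = ‖energyDeriv hf lam (U i)‖ * ‖U i‖⁻¹ := by field_simp
      rw [e1, add_mul, add_mul, e2] at h2
      exact h2)
    norm_num at hle
    by_contra hcon
    push Not at hcon
    have : 0 < (μ / 2 - 1) * (1 - lam * ‖w‖ ^ 2) := mul_pos (by linarith) hcon
    linarith
  -- The weighted integrals of `|v i|^μ` tend to zero.
  have hbnn : ∀ (z : X0 h), 0 ≤ᵐ[volume.restrict Ω] fun x => b x * |z x| ^ μ := fun z => by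
    filter_upwards [ae_mem h] with x hx
    have := hbpos x hx
    positivity
  have hbm : ∀ (z : X0 h), Measurable fun x => b x * |z x| ^ μ := fun z => by
    have h1 := measurable_coe z
    have h2 := hbc.measurable
    fun_prop
  have hbint : ∀ z : X0 h, IntegrableOn (fun x => b x * |z x| ^ μ) Ω := by
    intro z
    refine Integrable.mono' ((integrableOn_primitive hf z).add (integrable_const C₁))
      (hbm z).aestronglyMeasurable ?_
    filter_upwards [ae_mem h, hbnn z] with x hx hx0
    rw [Real.norm_of_nonneg hx0]
    exact hlow x hx _
  have hbzero : Tendsto (fun i => ∫ x in Ω, b x * |(v i) x| ^ μ) atTop (𝓝 0) := by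
    have hρ : Tendsto (fun i => ‖U i‖ ^ (-(μ - 2))) atTop (𝓝 0) :=
      (tendsto_rpow_neg_atTop (by linarith)).comp hinf
    have hlim : Tendsto (fun i => ‖U i‖ ^ (-(μ - 2)) * (1 / 2 - lam / 2 * ‖toL2 h (v i)‖ ^ 2
        - energy h f lam (U i) * ‖U i‖⁻¹ ^ 2 + C₁ * volume.real Ω * ‖U i‖⁻¹ ^ 2)) atTop
        (𝓝 (0 * (1 / 2 - lam / 2 * ‖w‖ ^ 2 - c * 0 ^ 2 + C₁ * volume.real Ω * 0 ^ 2))) :=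
      hρ.mul ((((hwn.const_mul (lam / 2)).const_sub (1 / 2)).sub (hJ.mul (hinv.pow 2))).add
        ((hinv.pow 2).const_mul _))
    rw [zero_mul] at hlim
    refine squeeze_zero' (Eventually.of_forall fun i => integral_nonneg_of_ae (hbnn (v i))) ?_ hlim
    filter_upwards [hpos] with i hi
    have h1 : ∫ x in Ω, b x * |(v i) x| ^ μ = ‖U i‖ ^ (-μ) * ∫ x in Ω, b x * |(U i) x| ^ μ := by
      rw [← integral_const_mul]
      refine integral_congr_ae ?_
      filter_upwards [ae_restrict_of_ae (coe_smul ‖U i‖⁻¹ (U i))] with x hx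
      change b x * |(‖U i‖⁻¹ • U i : X0 h) x| ^ μ = _
      rw [hx, abs_mul, abs_inv, abs_norm, Real.mul_rpow (by positivity) (abs_nonneg _),
        Real.inv_rpow hi.le, Real.rpow_neg hi.le]
      ring
    have h2 : ∫ x in Ω, b x * |(U i) x| ^ μ
        ≤ (∫ x in Ω, primitive f x ((U i) x)) + C₁ * volume.real Ω := by
      have h3 : ∫ x in Ω, b x * |(U i) x| ^ μ ≤ ∫ x in Ω, (primitive f x ((U i) x) + C₁) := by
        refine integral_mono_ae (hbint _)
          ((integrableOn_primitive hf _).add (integrable_const _)) ?_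
        filter_upwards [ae_mem h] with x hx
        exact hlow x hx _
      refine h3.trans_eq ?_
      rw [integral_add (integrableOn_primitive hf _) (integrable_const _), integral_const,
        smul_eq_mul, measureReal_restrict_apply_univ, mul_comm C₁]
    have h4 := energy_eq (f := f) (lam := lam) (U i)
    rw [hscale i hi] at h4
    have e1 : ‖U i‖ ^ (-(μ - 2)) = ‖U i‖ ^ (-μ) * ‖U i‖ ^ 2 := by
      rw [← Real.rpow_natCast, ← Real.rpow_add hi]
      congr 1
      push_cast
      ring
    rw [h1, e1, mul_assoc]
    refine mul_le_mul_of_nonneg_left (h2.trans_eq ?_) (by positivity)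
    have e2 : ‖U i‖ ^ 2 * ‖U i‖⁻¹ ^ 2 = 1 := by field_simp
    linear_combination h4 + (C₁ * volume.real Ω - energy h f lam (U i)) * (-e2)
  -- Fatou's lemma.
  have hlimae : ∀ᵐ x, Tendsto (fun i => (v i) x) atTop (𝓝 (w x)) := by
    filter_upwards [hae, ae_all_iff.2 fun i => coeFn_toL2 (v i)] with x hx hx'
    exact hx.congr fun i => hx' i
  have hfatou : ∫⁻ x in Ω, ENNReal.ofReal (b x * |w x| ^ μ) = 0 := by
    refine le_antisymm ?_ bot_le
    calc ∫⁻ x in Ω, ENNReal.ofReal (b x * |w x| ^ μ)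
        = ∫⁻ x in Ω, liminf (fun i => ENNReal.ofReal (b x * |(v i) x| ^ μ)) atTop := by
          refine lintegral_congr_ae ?_
          filter_upwards [ae_restrict_of_ae hlimae] with x hx
          refine (Tendsto.liminf_eq (ENNReal.tendsto_ofReal ?_)).symm
          exact (hx.abs.rpow_const (Or.inr (by linarith))).const_mul _
      _ ≤ liminf (fun i => ∫⁻ x in Ω, ENNReal.ofReal (b x * |(v i) x| ^ μ)) atTop :=
          lintegral_liminf_le fun i => (hbm (v i)).ennreal_ofReal
      _ = 0 := by
          have h1 : ∀ i, ∫⁻ x in Ω, ENNReal.ofReal (b x * |(v i) x| ^ μ)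
              = ENNReal.ofReal (∫ x in Ω, b x * |(v i) x| ^ μ) := fun i =>
            (ofReal_integral_eq_lintegral_ofReal (hbint _) (hbnn _)).symm
          simp_rw [h1]
          have := (ENNReal.tendsto_ofReal hbzero).liminf_eq
          rwa [ENNReal.ofReal_zero] at this
  have hwm : AEMeasurable (fun x => ENNReal.ofReal (b x * |w x| ^ μ)) (volume.restrict Ω) := by
    have h1 := (Lp.stronglyMeasurable w).measurable
    have h2 := hbc.measurable
    fun_prop
  have hwΩ := (ae_restrict_iff' h.isOpen.measurableSet).1 ((lintegral_eq_zero_iff' hwm).1 hfatou)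
  have hw0 : w = 0 := by
    refine (Lp.eq_zero_iff_ae_eq_zero).2 ?_
    filter_upwards [hwΩ, hlimae, ae_all_iff.2 fun i => ae_eq_zero_off (v i)] with x hx hxl hx'
    by_cases hxΩ : x ∈ Ω
    · have h1 := ENNReal.ofReal_eq_zero.1 (hx hxΩ)
      have h2 : |w x| ^ μ ≤ 0 := nonpos_of_mul_nonpos_right h1 (hbpos x hxΩ)
      have h3 := (Real.rpow_eq_zero_iff_of_nonneg (abs_nonneg _)).1
        (le_antisymm h2 (by positivity))
      exact abs_eq_zero.1 h3.1
    · exact tendsto_nhds_unique hxl (tendsto_const_nhds.congr fun i => (hx' i hxΩ).symm)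
  rw [hw0, norm_zero] at hwpos
  norm_num at hwpos

/-- On bounded sets of `X₀`, subcritical growth makes the nonlinear term small wherever the test
function is small in `L²`. -/
theorem exists_abs_nonlinearForm_le (hf : IsSubcritical (critExp n s) Ω f) {R : ℝ} (hR : 0 ≤ R)
    {ε : ℝ} (hε : 0 < ε) : ∃ C ≥ 0, ∀ u φ : X0 h, ‖u‖ ≤ R → ‖φ‖ ≤ R →
      |nonlinearForm hf u φ| ≤ ε + C * ‖toL2 h φ‖ ^ 2 := by
  have hP := two_lt_critExp h.s_pos h.two_s_lt
  have := isFiniteMeasure_restrict h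
  obtain ⟨D, hD, hint⟩ := exists_integral_one_add_rpow_mul_le h
  set P := critExp n s with hPdef
  set B := D * (1 + R ^ P) * R with hB
  have hB0 : 0 ≤ B := by positivity
  set ε₁ := ε / (2 * (B + 1)) with hε₁
  have hε₁pos : 0 < ε₁ := by positivity
  obtain ⟨C, hC, hgr⟩ := hf.growth ε₁ hε₁pos
  set V := volume.real Ω with hV
  set ε₂ := ε / (2 * (V + 1)) with hε₂
  have hV0 : 0 ≤ V := measureReal_nonneg
  have hε₂pos : 0 < ε₂ := by positivity
  refine ⟨C ^ 2 / ε₂, by positivity, fun u φ hu hφ => ?_⟩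
  have i1 : IntegrableOn (fun x => C ^ 2 / ε₂ * φ x ^ 2) Ω :=
    ((memLp_two φ).integrable_sq.const_mul _).integrableOn
  have i2 : IntegrableOn (fun x => ε₂ + C ^ 2 / ε₂ * φ x ^ 2) Ω := (integrable_const _).add i1
  have i3 := (integrableOn_one_add_rpow_mul u φ).const_mul ε₁
  have h1 : |nonlinearForm hf u φ| ≤ ∫ x in Ω, ((ε₂ + C ^ 2 / ε₂ * φ x ^ 2)
      + ε₁ * ((1 + |u x| ^ (P - 1)) * |φ x|)) := by
    rw [nonlinearForm_apply]
    rw [← Real.norm_eq_abs]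
    refine norm_integral_le_of_norm_le (i2.add i3) ?_
    filter_upwards [ae_mem h] with x hx
    rw [Real.norm_eq_abs, abs_mul]
    have h2 := mul_le_mul_of_nonneg_right (hgr x hx (u x)) (abs_nonneg (φ x))
    have h3 : C * |φ x| ≤ ε₂ + C ^ 2 / ε₂ * φ x ^ 2 := by
      have h4 : C ^ 2 / ε₂ * φ x ^ 2 = (C * |φ x|) ^ 2 / ε₂ := by rw [mul_pow, sq_abs]; ring
      rw [h4, ← sub_le_iff_le_add', le_div_iff₀ hε₂pos]
      nlinarith [sq_nonneg (C * |φ x| - ε₂), sq_nonneg (C * |φ x|)]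
    have h5 : 0 ≤ ε₁ * |φ x| := by positivity
    linarith
  refine h1.trans ?_
  rw [integral_add i2 i3, integral_add (integrable_const _) i1, integral_const_mul,
    integral_const_mul, ← norm_toL2_sq, integral_const, smul_eq_mul,
    measureReal_restrict_apply_univ]
  have h6 : ε₁ * ∫ x in Ω, (1 + |u x| ^ (P - 1)) * |φ x| ≤ ε / 2 := by
    have h7 : ∫ x in Ω, (1 + |u x| ^ (P - 1)) * |φ x| ≤ B := by
      refine (hint u φ).trans ?_
      rw [hB]
      gcongr
    calc _ ≤ ε₁ * (B + 1) := by gcongr; linarith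
      _ = ε / 2 := by rw [hε₁]; field_simp
  have h8 : V * ε₂ ≤ ε / 2 := by
    calc V * ε₂ ≤ (V + 1) * ε₂ := by gcongr; linarith
      _ = ε / 2 := by rw [hε₂]; field_simp
  linarith

theorem norm_sub_sq_eq (hf : IsSubcritical (critExp n s) Ω f) (u v : X0 h) :
    ‖u - v‖ ^ 2 = energyDeriv hf lam u (u - v) - energyDeriv hf lam v (u - v)
      + lam * ‖toL2 h (u - v)‖ ^ 2
      + (nonlinearForm hf u (u - v) - nonlinearForm hf v (u - v)) := by
  rw [energyDeriv_apply, energyDeriv_apply, ← real_inner_self_eq_norm_sq,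
    ← real_inner_self_eq_norm_sq]
  have h1 : inner ℝ (u - v) (u - v) = inner ℝ u (u - v) - inner ℝ v (u - v) := inner_sub_left _ _ _
  have h2 : inner ℝ (toL2 h (u - v)) (toL2 h (u - v))
      = inner ℝ (toL2 h u) (toL2 h (u - v)) - inner ℝ (toL2 h v) (toL2 h (u - v)) := by
    rw [← inner_sub_left, map_sub]
  rw [h1, h2]
  ring

/-- A bounded sequence along which the derivative of the energy tends to zero is Cauchy as soon as
it converges in `L²`. -/
theorem cauchySeq_of_toL2 (hf : IsSubcritical (critExp n s) Ω f) {u : ℕ → X0 h} {R : ℝ}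
    (hR : ∀ j, ‖u j‖ ≤ R) (hJ' : Tendsto (fun j => ‖energyDeriv hf lam (u j)‖) atTop (𝓝 0))
    (hL2 : CauchySeq fun j => toL2 h (u j)) : CauchySeq u := by
  have hR0 : 0 ≤ R := (norm_nonneg _).trans (hR 0)
  rw [Metric.cauchySeq_iff]
  intro η hη
  set ε := η ^ 2 / 8 with hε
  have hεpos : 0 < ε := by positivity
  obtain ⟨C, hC, hform⟩ := exists_abs_nonlinearForm_le (h := h) hf
    (show 0 ≤ 2 * R by positivity) hεpos
  obtain ⟨N₁, hN₁⟩ := eventually_atTop.1 (hJ'.eventually_lt_const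
    (show 0 < ε / (2 * R + 1) by positivity))
  obtain ⟨N₂, hN₂⟩ := Metric.cauchySeq_iff.1 hL2 (√(ε / (|lam| + 2 * C + 1))) (by positivity)
  refine ⟨max N₁ N₂, fun i hi j hj => ?_⟩
  have hsub : ‖u i - u j‖ ≤ 2 * R := by
    refine (norm_sub_le _ _).trans ?_
    linarith [hR i, hR j]
  have hd : ∀ l, max N₁ N₂ ≤ l → |energyDeriv hf lam (u l) (u i - u j)| ≤ ε := by
    intro l hl
    calc |energyDeriv hf lam (u l) (u i - u j)|
        ≤ ‖energyDeriv hf lam (u l)‖ * ‖u i - u j‖ :=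
          (energyDeriv hf lam (u l)).le_opNorm _
      _ ≤ ε / (2 * R + 1) * (2 * R + 1) := by
          refine mul_le_mul (hN₁ l ((le_max_left _ _).trans hl)).le (by linarith)
            (norm_nonneg _) (by positivity)
      _ = ε := by field_simp
  have hl2 : (|lam| + 2 * C) * ‖toL2 h (u i - u j)‖ ^ 2 ≤ ε := by
    have h1 := hN₂ i ((le_max_right _ _).trans hi) j ((le_max_right _ _).trans hj)
    rw [dist_eq_norm, ← map_sub, Real.lt_sqrt (norm_nonneg _),
      lt_div_iff₀ (by positivity)] at h1
    nlinarith [sq_nonneg ‖toL2 h (u i - u j)‖]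
  have hi' := abs_le.1 (hd i hi)
  have hj' := abs_le.1 (hd j hj)
  have hfi := abs_le.1 (hform (u i) (u i - u j) (by linarith [hR i]) hsub)
  have hfj := abs_le.1 (hform (u j) (u i - u j) (by linarith [hR j]) hsub)
  have hlam := mul_le_mul_of_nonneg_right (le_abs_self lam) (sq_nonneg ‖toL2 h (u i - u j)‖)
  have heq := norm_sub_sq_eq (lam := lam) hf (u i) (u j)
  rw [dist_eq_norm]
  refine lt_of_pow_lt_pow_left₀ 2 hη.le ?_
  rw [heq]
  have : 5 * ε < η ^ 2 := by rw [hε]; nlinarith [sq_pos_of_pos hη]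
  linarith [hi'.2, hj'.1, hfi.2, hfj.1]

theorem palaisSmaleAt_energy (hf : IsSubcritical (critExp n s) Ω f)
    (hAR : AmbrosettiRabinowitz Ω f) (c : ℝ) : PalaisSmaleAt (energy h f lam) c := by
  intro u hJ hJ'
  have hfd : ∀ j, fderiv ℝ (energy h f lam) (u j) = energyDeriv hf lam (u j) := fun j =>
    (hasFDerivAt_energy hf (u j)).fderiv
  simp_rw [hfd] at hJ'
  have hnot := not_tendsto_norm_atTop hf hAR hJ hJ'
  rw [tendsto_atTop] at hnot
  push Not at hnot
  obtain ⟨R, hR⟩ := hnot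
  obtain ⟨k₁, hk₁, hb⟩ := extraction_of_frequently_atTop hR
  obtain ⟨k₂, hk₂, z, hz⟩ := exists_subseq_toL2_tendsto (u := fun i => u (k₁ i)) (R := R)
    (fun i => (hb i).le)
  have hcau : CauchySeq fun i => u (k₁ (k₂ i)) :=
    cauchySeq_of_toL2 hf (fun i => (hb (k₂ i)).le)
      (hJ'.comp (hk₁.comp hk₂).tendsto_atTop) hz.cauchySeq
  obtain ⟨w, hw⟩ := exists_tendsto_of_cauchySeq hcau
  exact ⟨w, fun i => k₁ (k₂ i), hk₁.comp hk₂, hw⟩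

end X0

/-! ### Reduction to a globally continuous nonlinearity -/

/-- Tietze's theorem on the closed set `closure Ω ×ˢ univ`. The energy, the growth condition and the
Ambrosetti–Rabinowitz condition only see the values of the nonlinearity over `Ω`. -/
theorem exists_continuous_extension {n : ℕ} {Ω : Set (Rn n)} {f : Rn n → ℝ → ℝ}
    (hf : ContinuousOn (fun p : Rn n × ℝ => f p.1 p.2) (closure Ω ×ˢ univ)) :
    ∃ g : Rn n → ℝ → ℝ, Continuous (Function.uncurry g) ∧ ∀ x ∈ Ω, g x = f x := by
  obtain ⟨G, hG⟩ := ContinuousMap.exists_restrict_eq (isClosed_closure.prod isClosed_univ)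
    (⟨_, continuousOn_iff_continuous_domRestrict.1 hf⟩ : C(closure Ω ×ˢ (univ : Set ℝ), ℝ))
  refine ⟨fun x t => G (x, t), G.continuous, fun x hx => funext fun t => ?_⟩
  exact DFunLike.congr_fun hG ⟨(x, t), subset_closure hx, mem_univ t⟩

end NonlocalPS

end

theorem proposition3p1 {n : ℕ} {s : ℝ} {Ω : Set (NonlocalPS.Rn n)} {K : NonlocalPS.Rn n → ℝ}
    (h : NonlocalPS.StandingAssumptions s Ω K)
    (f : NonlocalPS.Rn n → ℝ → ℝ)
    (hf_cont : ContinuousOn (fun p : NonlocalPS.Rn n × ℝ => f p.1 p.2) (closure Ω ×ˢ Set.univ))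
    (hf_growth : NonlocalPS.SubcriticalGrowth s Ω f)
    (hf_AR : NonlocalPS.AmbrosettiRabinowitz Ω f)
    (lam : ℝ) :
    (∀ u : NonlocalPS.X0 h,
      MeasureTheory.IntegrableOn (fun x => NonlocalPS.primitive f x (u x)) Ω) ∧
    Differentiable ℝ (NonlocalPS.energy h f lam) ∧
    ∀ c : ℝ, NonlocalPS.PalaisSmaleAt (NonlocalPS.energy h f lam) c := by
  open NonlocalPS in
  obtain ⟨g, hg, hgf⟩ := exists_continuous_extension hf_cont
  have hprim : ∀ x ∈ Ω, primitive g x = primitive f x := fun x hx => by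
    funext t
    rw [primitive, primitive, hgf x hx]
  have hgrowth : SubcriticalGrowth s Ω g := by
    obtain ⟨a₁, h₁, a₂, h₂, q, hq, hq', hb⟩ := hf_growth
    exact ⟨a₁, h₁, a₂, h₂, q, hq, hq', fun x hx => by rw [hgf x hx]; exact hb x hx⟩
  have hAR : AmbrosettiRabinowitz Ω g := by
    obtain ⟨μ, hμ, r, hr, hb⟩ := hf_AR
    exact ⟨μ, hμ, r, hr, fun x hx => by rw [hgf x hx, hprim x hx]; exact hb x hx⟩
  have hsub := hgrowth.isSubcritical hg
  have henergy : energy h g lam = energy h f lam := by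
    funext u
    rw [energy, energy, setIntegral_congr_fun (f := fun x => primitive g x (u x))
      (g := fun x => primitive f x (u x)) h.isOpen.measurableSet
      (fun x hx => congrFun (hprim x hx) _)]
  refine ⟨fun u => ?_, ?_, fun c => ?_⟩
  · exact (X0.integrableOn_primitive hsub u).congr_fun (fun x hx => congrFun (hprim x hx) _)
      h.isOpen.measurableSet
  · rw [← henergy]
    exact fun u => (X0.hasFDerivAt_energy hsub u).differentiableAt
  · rw [← henergy]
    exact X0.palaisSmaleAt_energy hsub hAR c
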